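/- **Setting.** Units with speed of light and particle mass equal to one are used. For $\zeta>0$ let $K_n(\zeta)=\int_0^\infty\cosh(n\vartheta)e^{-\zeta\cosh\vartheta}\,d\vartheta$, and for $\ell=0,1$ let $P_n^{(\ell)}(x;\zeta)$, $n\ge 0$, be the polynomial of degree $n$ with positive leading coefficient in the orthonormal family with respect to the weight $\omega^{(\ell)}(x;\zeta)=K_1(\zeta)^{-1}(x^2-1)^{\ell-1/2}e^{-\zeta x}$ on $(1,\infty)$. For $|u|<1$, $\theta>0$, $p\in\mathbb R$ put $\zeta=1/\theta$, $U^0=(1-u^2)^{-1/2}$, $U^1=uU^0$, $p^0=\sqrt{1+p^2}$, $E=U^0p^0-U^1p$, $p_{<1>}=-p+U^1E$, $g_{[u,\theta]}=\frac{1}{2K_1(\zeta)}e^{-E/\theta}$, $$\tilde P^{(0)}_n[u,\theta]=g_{[u,\theta]}P^{(0)}_n(E;\zeta),\qquad \tilde P^{(1)}_n[u,\theta]=g_{[u,\theta]}(U^0)^{-1}P^{(1)}_n(E;\zeta)\,p_{<1>},\qquad \langle f,h\rangle=\int_{\mathbb R}\frac{f(p)h(p)}{g_{[u,\theta]}(p)}\frac{dp}{p^0}.$$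 For $M\ge1$ let $\mathcal P_0,\dots,\mathcal P_{2M}$ denote $\tilde P^{(0)}_0,\tilde P^{(0)}_1,\tilde P^{(1)}_0,\dots,\tilde P^{(0)}_M,\tilde P^{(1)}_{M-1}$ in this order, and let $\Pi_M[u,\theta]f=\sum_{k=0}^{2M}\langle f,\mathcal P_k\rangle\mathcal P_k$. The state vector is $W_M=(\rho,u,\theta,\Pi,\tilde n^1,f^0_3,f^1_2,\dots,f^0_M,f^1_{M-1})\in\mathbb R^{2M+1}$ (for $M=1$ it is $(\rho,u,\theta)$, and $\Pi=\tilde n^1=0$). It represents the distribution function $$F_M(W_M)=\sum_{i=0}^{M}f^0_i\,\tilde P^{(0)}_i[u,\theta]+\sum_{j=0}^{M-1}f^1_j\,\tilde P^{(1)}_j[u,\theta],$$ whose lower coefficients are $f^0_0=\rho/c_0-\Pi\,P^{(0)}_0(0;\zeta)$ with $c_0=P^{(0)}_0$, $f^0_i=-\Pi\,P^{(0)}_i(0;\zeta)$ for $i=1,2$, and $f^1_j=-\tilde n^1P^{(1)}_j(0;\zeta)$ for $j=0,1$. (These values express that $\rho$, $\Pi$ and $\tilde n^1=n^1\sqrt{1-u^2}$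 are the mass density, the bulk viscous pressure and the scaled diffusion current of $F_M$, that $\theta$ is fixed by the energy density of the local equilibrium $\rho g_{[u,\theta]}$, and that $u$ is the velocity in the Landau–Lifshitz frame.) The moment system of order $M$, obtained by operator projection from the one-dimensional relativistic Boltzmann equation $p^0\partial_tf+p\,\partial_xf=Q(f,f)$, is $$B^0_M(W_M)\,\partial_tW_M+B^1_M(W_M)\,\partial_xW_M=S(W_M),$$ where, for $0\le k,j\le 2M$, the entries $(B^0_M)_{kj}$ and $(B^1_M)_{kj}$ are the coefficients at $\mathcal P_k$ of $$\Pi_M[u,\theta]\Big(p^0\,\Pi_M[u,\theta]\frac{\partial F_M}{\partial W_{M,j}}\Big)\quad\text{and}\quad \Pi_M[u,\theta]\Big(p\,\Pi_M[u,\theta]\frac{\partial F_M}{\partial W_{M,j}}\Big),$$ respectively, and the source term $S(W_M)$ contains no derivatives of $W_M$. **Theorem (Hyperbolicity).** For every $M\ge1$ the moment system is strictly hyperbolic on the set of admissible states: for every $W_M$ with $\rho>0$, $|u|<1$, $\theta>0$ and $\Pi>-\rho\theta$, the matrix $B^0_M(W_M)$ is invertible and $B_M=(B^0_M)^{-1}B^1_M$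 has $2M+1$ distinct real eigenvalues. Moreover, for every such state the spectral radius of $B_M$ is less than one. -/

import Mathlib

namespace RelMoment

open Polynomial

noncomputable section

/-- Modified Bessel function of the second kind, `K_n(ζ)`. -/
def besselK (n : ℕ) (ζ : ℝ) : ℝ :=
  ∫ y in Set.Ioi (0 : ℝ), Real.cosh (n * y) * Real.exp (-ζ * Real.cosh y)

/-- The weight `ω^{(ℓ)}(x;ζ) = (x² - 1)^{ℓ - 1/2} exp(-ζ x) / K₁(ζ)` on `(1,∞)`. -/
def weight (l : ℕ) (ζ x : ℝ) : ℝ :=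
  (x ^ 2 - 1) ^ ((l : ℝ) - 1 / 2) / besselK 1 ζ * Real.exp (-ζ * x)

/-- The inner product `(P, Q)_{ω^{(ℓ)}}` of two polynomials. -/
def polyInner (l : ℕ) (ζ : ℝ) (P Q : ℝ[X]) : ℝ :=
  ∫ x in Set.Ioi (1 : ℝ), P.eval x * Q.eval x * weight l ζ x

/-- The orthonormal polynomial `P_n^{(ℓ)}(·;ζ)` of degree `n` with positive leading coefficient,
obtained from `1, x, x², …` by the Gram–Schmidt process. -/
def orthoPoly (l : ℕ) (ζ : ℝ) (n : ℕ) : ℝ[X] :=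
  let Q : ℝ[X] := X ^ n - ∑ k : Fin n,
    C (polyInner l ζ (X ^ n) (orthoPoly l ζ k.1)) * orthoPoly l ζ k.1
  C (Real.sqrt (polyInner l ζ Q Q))⁻¹ * Q
termination_by n
decreasing_by all_goals exact k.2

/-- Velocity component `U⁰`, the Lorentz factor (units `c = m = 1`). -/
def U0 (u : ℝ) : ℝ := (Real.sqrt (1 - u ^ 2))⁻¹

/-- Velocity component `U¹`. -/
def U1 (u : ℝ) : ℝ := u * U0 u

/-- `p⁰ = √(1 + p²)`. -/
def p0 (p : ℝ) : ℝ := Real.sqrt (1 + p ^ 2)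

/-- `E = U_α p^α`. -/
def energy (u p : ℝ) : ℝ := U0 u * p0 p - U1 u * p

/-- `p_{<1>} = Δ_{1β} p^β = g_{1β} p^β - U_1 U_β p^β`, where `U_1 = -U¹`. -/
def pPerp (u p : ℝ) : ℝ := -p + U1 u * energy u p

/-- The equilibrium weight `g⁽⁰⁾_{[u,θ]}`. -/
def g0 (u θ p : ℝ) : ℝ := 1 / (2 * besselK 1 θ⁻¹) * Real.exp (-(energy u p / θ))

/-- The inner product `⟨f, h⟩` with weight `1 / g⁽⁰⁾_{[u,θ]}` and measure `dp / p⁰`. -/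
def inner0 (u θ : ℝ) (f h : ℝ → ℝ) : ℝ :=
  ∫ p : ℝ, 1 / g0 u θ p * f p * h p / p0 p

/-- The basis function `g⁽⁰⁾ P_n^{(0)}(E;ζ)`, with `ζ = 1/θ`. -/
def basisEven (u θ : ℝ) (n : ℕ) (p : ℝ) : ℝ :=
  g0 u θ p * (orthoPoly 0 θ⁻¹ n).eval (energy u p)

/-- The basis function `g⁽⁰⁾ (U⁰)⁻¹ P_n^{(1)}(E;ζ) p_{<1>}`, with `ζ = 1/θ`. -/
def basisOdd (u θ : ℝ) (n : ℕ) (p : ℝ) : ℝ :=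
  g0 u θ p * (U0 u)⁻¹ * (orthoPoly 1 θ⁻¹ n).eval (energy u p) * pPerp u p

/-- The basis in the order `P̃₀⁽⁰⁾, P̃₁⁽⁰⁾, P̃₀⁽¹⁾, P̃₂⁽⁰⁾, P̃₁⁽¹⁾, …` (numbered from `0`): the number
`2n - 1` is `P̃_n⁽⁰⁾` and the number `2n` is `P̃_{n-1}⁽¹⁾`, for `n ≥ 1`. -/
def basisFn (u θ : ℝ) (i : ℕ) : ℝ → ℝ :=
  if i = 0 ∨ i % 2 = 1 then basisEven u θ ((i + 1) / 2) else basisOdd u θ (i / 2 - 1)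

/-- The projection `Π_M[u,θ]` onto the span of the first `2M + 1` basis functions. -/
def proj (M : ℕ) (u θ : ℝ) (f : ℝ → ℝ) (p : ℝ) : ℝ :=
  ∑ i : Fin (2 * M + 1), inner0 u θ f (basisFn u θ i) * basisFn u θ i p

/-- The `k`-th component (numbered from `0`) of a state vector
`W = (ρ, u, θ, Π, ñ¹, f₃⁰, f₂¹, …, f_M⁰, f_{M-1}¹)`; components which `W` does not have
(`Π` and `ñ¹` if `M = 1`) are zero. -/
def comp {M : ℕ} (W : Fin (2 * M + 1) → ℝ) (k : ℕ) : ℝ :=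
  if h : k < 2 * M + 1 then W ⟨k, h⟩ else 0

def density {M : ℕ} (W : Fin (2 * M + 1) → ℝ) : ℝ := comp W 0
def velocity {M : ℕ} (W : Fin (2 * M + 1) → ℝ) : ℝ := comp W 1
def temperature {M : ℕ} (W : Fin (2 * M + 1) → ℝ) : ℝ := comp W 2
def bulkPressure {M : ℕ} (W : Fin (2 * M + 1) → ℝ) : ℝ := comp W 3
def diffusion {M : ℕ} (W : Fin (2 * M + 1) → ℝ) : ℝ := comp W 4

/-- The expansion coefficients `(f₀⁰, f₁⁰, f₀¹, f₂⁰, f₁¹, f₃⁰, f₂¹, …)` in terms of `W`.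
The deviation `δ = f - ρ g⁽⁰⁾` from equilibrium satisfies (integrals with respect to `dp/p⁰`)
`∫ E δ = ∫ E² δ = 0` (matching of mass and energy density), `∫ (E² - 1) δ = Π`,
`∫ (U⁰)⁻¹ p_{<1>} δ = -ñ¹` and `∫ E p_{<1>} δ = 0` (Landau–Lifshitz frame). Hence
`⟨δ, P̃_n⁽⁰⁾⟩ = -Π P_n⁽⁰⁾(0)` for `n ≤ 2` and `⟨δ, P̃_n⁽¹⁾⟩ = -ñ¹ P_n⁽¹⁾(0)` for `n ≤ 1`, while
`ρ g⁽⁰⁾` has the only coefficient `ρ / c₀⁽⁰⁾`, where `c₀⁽⁰⁾` is the constant `P₀⁽⁰⁾`. -/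
def momentCoeff {M : ℕ} (W : Fin (2 * M + 1) → ℝ) : ℕ → ℝ
  | 0 => density W / (orthoPoly 0 (temperature W)⁻¹ 0).leadingCoeff
      - bulkPressure W * (orthoPoly 0 (temperature W)⁻¹ 0).eval 0
  | 1 => -bulkPressure W * (orthoPoly 0 (temperature W)⁻¹ 1).eval 0
  | 2 => -diffusion W * (orthoPoly 1 (temperature W)⁻¹ 0).eval 0
  | 3 => -bulkPressure W * (orthoPoly 0 (temperature W)⁻¹ 2).eval 0
  | 4 => -diffusion W * (orthoPoly 1 (temperature W)⁻¹ 1).eval 0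
  | (i + 5) => comp W (i + 5)

/-- The projected distribution function `Π_M[u,θ] f`, as a function of `W` and `p`. -/
def distribution (M : ℕ) (W : Fin (2 * M + 1) → ℝ) (p : ℝ) : ℝ :=
  ∑ i : Fin (2 * M + 1), momentCoeff W i * basisFn (velocity W) (temperature W) i p

/-- The partial derivative of the projected distribution function with respect to `W_j`. -/
def distributionDeriv (M : ℕ) (W : Fin (2 * M + 1) → ℝ) (j : Fin (2 * M + 1)) (p : ℝ) : ℝ :=
  deriv (fun s => distribution M (Function.update W j s) p) (W j)

/-- The coefficient matrix of the moment system that belongs to the factor `a` (`a = p⁰` for the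
time derivative, `a = p` for the space derivative). Its entry `(k, j)` is the coefficient at the
`k`-th basis function of `Π_M (a Π_M (∂/∂W_j Π_M f))`. -/
def momentMatrix (M : ℕ) (a : ℝ → ℝ) (W : Fin (2 * M + 1) → ℝ) :
    Matrix (Fin (2 * M + 1)) (Fin (2 * M + 1)) ℝ :=
  Matrix.of fun k j =>
    inner0 (velocity W) (temperature W)
      (fun p => a p * proj M (velocity W) (temperature W) (distributionDeriv M W j) p)
      (basisFn (velocity W) (temperature W) k)

/-- The matrix `B⁰_M(W)`. -/
def B0 (M : ℕ) (W : Fin (2 * M + 1) → ℝ) : Matrix (Fin (2 * M + 1)) (Fin (2 * M + 1)) ℝ :=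
  momentMatrix M p0 W

/-- The matrix `B¹_M(W)`. -/
def B1 (M : ℕ) (W : Fin (2 * M + 1) → ℝ) : Matrix (Fin (2 * M + 1)) (Fin (2 * M + 1)) ℝ :=
  momentMatrix M (fun p => p) W

/-- Admissible states: `ρ > 0`, `|u| < 1`, `θ > 0`, `Π > -ρθ`. -/
def Admissible {M : ℕ} (W : Fin (2 * M + 1) → ℝ) : Prop :=
  0 < density W ∧ |velocity W| < 1 ∧ 0 < temperature W ∧
    -(density W * temperature W) < bulkPressure W

/-- A first order system `A⁰(W) ∂_t W + A¹(W) ∂_x W = S(W)` of `n` equations is strictly hyperbolic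
on a set `Ω` of states if at each state `A⁰` is invertible and `(A⁰)⁻¹ A¹` has `n` distinct real
eigenvalues. -/
def IsStrictlyHyperbolicOn {n : ℕ} (A0 A1 : (Fin n → ℝ) → Matrix (Fin n) (Fin n) ℝ)
    (Ω : Set (Fin n → ℝ)) : Prop :=
  ∀ W ∈ Ω, IsUnit (A0 W) ∧
    ∃ lam : Fin n → ℝ, StrictMono lam ∧
      ∀ i, Module.End.HasEigenvalue (Matrix.toLin' ((A0 W)⁻¹ * A1 W)) (lam i)

end

end RelMoment

namespace RelMoment

open Polynomial MeasureTheory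

noncomputable section

/-! Substitute p = sinh y and x = y − η with η = artanh u. Then E = cosh x, p_<1> = −U⁰ sinh x and
dp/p⁰ = dx. After division by the equilibrium weight, the first 2M+1 basis functions become an
orthonormal basis of the Laurent polynomials in eˣ with exponents between −M and M, for the weight
exp(−ζ cosh x) up to normalization (`wint_mode_mul_mode`, `span_mode`). Therefore B⁰ = A⁰D and B¹ =
A¹D (`momentMatrix_eq`), where A⁰ and A¹ are the compressions of multiplication by cosh(x+η) and
sinh(x+η), and D contains the coefficients of the derivatives ∂F/∂W_j.

Suppose D is invertible. Since A⁰ is a positive definite Gram matrix, B is similar to a real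
symmetric matrix, with the eigenvalues of the pencil (A¹, A⁰). Both A⁰ ± A¹ are positive definite
because cosh ± sinh = exp(±·) > 0, so these eigenvalues lie in (−1, 1). They are simple: sinh(x+η) −
c cosh(x+η) is a positive multiple of sinh(x−x₀), so it changes sign exactly once. If an
eigenfunction f vanished at x₀, then f = (eˣ − e^{x₀})g with g in the same space, and testing
against g would make the integral of the nonnegative function sinh(x−x₀)fg zero. Evaluation at x₀ is
thus injective on each eigenspace (`pencil_kernel_eq_zero`, `pencil_kernel_dim`, `pencil_spectrum`).

Invertibility of D (`isUnit_derivMatrix`) is a triangular elimination. The moments of F against low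
powers of cosh, with or without a factor sinh, are explicit in ρ, θ, Π, ñ¹, and suitable test
functions detect one column of D after another. The pivots for u and θ are the nontrivial ones. The
first is where Π > −ρθ is needed (`derivMoment_velocity_ne_zero`); the second is a strict
Cauchy–Schwarz inequality (`derivMoment_temperature_ne_zero`). -/

/-! ### Spectra of definite symmetric pencils. -/

/-- A real symmetric definite pencil with one-dimensional kernels and all eigenvalues in `(-1, 1)`,
multiplied from the right by an invertible matrix. -/
theorem pencil_spectrum {n : ℕ} {A0 A1 D : Matrix (Fin n) (Fin n) ℝ} (h0 : A0.PosDef)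
    (h1 : A1.IsHermitian) (hp : (A0 + A1).PosDef) (hm : (A0 - A1).PosDef) (hD : IsUnit D)
    (hs : ∀ (c : ℝ) (v w : Fin n → ℝ), v ≠ 0 → A1.mulVec v = c • A0.mulVec v →
      A1.mulVec w = c • A0.mulVec w → ∃ a b : ℝ, (a ≠ 0 ∨ b ≠ 0) ∧ a • v + b • w = 0) :
    (IsUnit (A0 * D) ∧ ∃ lam : Fin n → ℝ, StrictMono lam ∧
      ∀ i, Module.End.HasEigenvalue (Matrix.toLin' ((A0 * D)⁻¹ * (A1 * D))) (lam i)) ∧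
    spectralRadius ℂ (((A0 * D)⁻¹ * (A1 * D)).map (algebraMap ℝ ℂ)) < 1 := by
  have hU0 : IsUnit A0 := h0.isUnit
  obtain ⟨S, hSu, hS⟩ : ∃ S : Matrix (Fin n) (Fin n) ℝ, IsUnit S ∧ A0 = S.conjTranspose * S := by
    open scoped MatrixOrder Matrix.Norms.L2Operator in
    obtain ⟨y, hy, hy'⟩ := CStarAlgebra.isStrictlyPositive_iff_eq_star_mul_self.mp
        h0.isStrictlyPositive
    exact ⟨y, hy, hy'⟩
  have hSd : IsUnit S.det := (Matrix.isUnit_iff_isUnit_det S).1 hSu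
  have hStd : IsUnit S.conjTranspose.det := by
    rw [Matrix.det_conjTranspose]; exact hSd.star
  obtain ⟨T, hTH, hA1⟩ : ∃ T : Matrix (Fin n) (Fin n) ℝ, T.IsHermitian ∧
      A1 = S.conjTranspose * T * S := by
    refine ⟨(S⁻¹).conjTranspose * A1 * S⁻¹, Matrix.isHermitian_conjTranspose_mul_mul _ h1, ?_⟩
    rw [Matrix.conjTranspose_nonsing_inv]
    simp only [Matrix.mul_assoc]
    rw [Matrix.nonsing_inv_mul _ hSd, Matrix.mul_one,
      Matrix.mul_nonsing_inv_cancel_left _ _ hStd]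
  -- Similarity to the symmetric matrix T; the factor D only changes the conjugating matrix.
  have hB : (A0 * D)⁻¹ * (A1 * D) = (S * D)⁻¹ * T * (S * D) := by
    rw [hA1, hS]
    simp only [Matrix.mul_inv_rev, Matrix.mul_assoc]
    rw [Matrix.nonsing_inv_mul_cancel_left _ _ hStd]
  have hPu : IsUnit (S * D) := hSu.mul hD
  have hPd : IsUnit (S * D).det := (Matrix.isUnit_iff_isUnit_det _).1 hPu
  obtain ⟨e, he, he0, hind⟩ : ∃ e : Fin n → Fin n → ℝ,
      (∀ i, T.mulVec (e i) = hTH.eigenvalues i • e i) ∧ (∀ i, e i ≠ 0) ∧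
      ∀ i j, i ≠ j → ∀ a b : ℝ, a • e i + b • e j = 0 → a = 0 ∧ b = 0 := by
    refine ⟨fun i => (hTH.eigenvectorBasis i).ofLp, fun i => hTH.mulVec_eigenvectorBasis i,
      fun i hi => hTH.eigenvectorBasis.orthonormal.ne_zero i (by ext k; exact congrFun hi k), ?_⟩
    intro i j hij a b h
    have h' : a • hTH.eigenvectorBasis i + b • hTH.eigenvectorBasis j = 0 := by
      ext k; exact congrFun h k
    have ho := orthonormal_iff_ite.1 hTH.eigenvectorBasis.orthonormal
    have ha := congrArg (inner ℝ (hTH.eigenvectorBasis i)) h'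
    have hb := congrArg (inner ℝ (hTH.eigenvectorBasis j)) h'
    simp only [inner_add_right, inner_smul_right, ho, inner_zero_right, hij, hij.symm, if_true,
      if_false, mul_one, mul_zero, add_zero, zero_add] at ha hb
    exact ⟨ha, hb⟩
  obtain ⟨v, hSv⟩ : ∃ v : Fin n → Fin n → ℝ, ∀ i, S.mulVec (v i) = e i :=
    ⟨fun i => S⁻¹.mulVec (e i), fun i => by
      rw [Matrix.mulVec_mulVec, Matrix.mul_nonsing_inv _ hSd, Matrix.one_mulVec]⟩
  have hv0 : ∀ i, v i ≠ 0 := by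
    intro i hi
    apply he0 i
    rw [← hSv i, hi, Matrix.mulVec_zero]
  have hv : ∀ i, A1.mulVec (v i) = hTH.eigenvalues i • A0.mulVec (v i) := by
    intro i
    rw [hA1, hS, ← Matrix.mulVec_mulVec, ← Matrix.mulVec_mulVec, ← Matrix.mulVec_mulVec, hSv, he,
      Matrix.mulVec_smul]
  -- A repeated eigenvalue would give two orthogonal eigenvectors of T, which S⁻¹ carries to
  -- independent vectors in one kernel of the pencil.
  have hinj : Function.Injective hTH.eigenvalues := by
    intro i j hij
    by_contra hne
    obtain ⟨a, b, hab, h⟩ := hs _ (v i) (v j) (hv0 i) (hv i) (by rw [hij]; exact hv j)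
    have h2 : a • e i + b • e j = 0 := by
      rw [← hSv i, ← hSv j, ← Matrix.mulVec_smul, ← Matrix.mulVec_smul, ← Matrix.mulVec_add, h,
        Matrix.mulVec_zero]
    have hpair := hind i j hne a b h2
    rcases hab with h | h
    · exact h hpair.1
    · exact h hpair.2
  have habs : ∀ i, |hTH.eigenvalues i| < 1 := by
    intro i
    have q0 := h0.dotProduct_mulVec_pos (hv0 i)
    have qp := hp.dotProduct_mulVec_pos (hv0 i)
    have qm := hm.dotProduct_mulVec_pos (hv0 i)
    rw [Matrix.add_mulVec, dotProduct_add, hv, dotProduct_smul, smul_eq_mul] at qp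
    rw [Matrix.sub_mulVec, dotProduct_sub, hv, dotProduct_smul, smul_eq_mul] at qm
    rw [abs_lt]
    constructor <;> nlinarith
  refine ⟨⟨hU0.mul hD, ?_⟩, ?_⟩
  · have hcard : (Finset.univ.image hTH.eigenvalues).card = n := by
      rw [Finset.card_image_of_injective _ hinj, Finset.card_univ, Fintype.card_fin]
    refine ⟨(Finset.univ.image hTH.eigenvalues).orderEmbOfFin hcard,
      (Finset.orderEmbOfFin _ hcard).strictMono, fun i => ?_⟩
    obtain ⟨j, -, hj⟩ := Finset.mem_image.1 (Finset.orderEmbOfFin_mem _ hcard i)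
    rw [← hj]
    apply Module.End.hasEigenvalue_of_hasEigenvector (x := (S * D)⁻¹.mulVec (e j))
    refine ⟨?_, ?_⟩
    · rw [Module.End.mem_eigenspace_iff, Matrix.toLin'_apply, hB, Matrix.mulVec_mulVec,
        Matrix.mul_assoc, Matrix.mul_nonsing_inv _ hPd, Matrix.mul_one, ← Matrix.mulVec_mulVec, he,
        Matrix.mulVec_smul]
    · intro h
      apply he0 j
      have := congrArg (S * D).mulVec h
      rwa [Matrix.mulVec_mulVec, Matrix.mul_nonsing_inv _ hPd, Matrix.one_mulVec,
        Matrix.mulVec_zero] at this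
  · have hchar : ((A0 * D)⁻¹ * (A1 * D)).charpoly = ∏ i, (X - C (hTH.eigenvalues i)) := by
      have hch := hTH.charpoly_eq
      simp only [RCLike.ofReal_real_eq_id, id_eq] at hch
      rw [hB, ← hch]
      have := Matrix.charpoly_units_conj' hPu.unit T
      simpa using this
    -- The spectral radius is a supremum, so a strict bound needs one r < 1 for all eigenvalues.
    obtain ⟨r, hr1, hr⟩ : ∃ r : NNReal, r < 1 ∧ ∀ i, ‖hTH.eigenvalues i‖₊ ≤ r := by
      refine ⟨Finset.univ.sup fun i => ‖hTH.eigenvalues i‖₊, ?_, fun i =>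
        Finset.le_sup (f := fun i => ‖hTH.eigenvalues i‖₊) (Finset.mem_univ i)⟩
      rw [Finset.sup_lt_iff (by simp)]
      intro i _
      rw [← NNReal.coe_lt_coe]
      simpa using habs i
    refine lt_of_le_of_lt (b := (r : ENNReal)) ?_ (by exact_mod_cast hr1)
    refine iSup₂_le fun k hk => ?_
    rw [Matrix.mem_spectrum_iff_isRoot_charpoly, Matrix.charpoly_map, hchar, Polynomial.IsRoot.def,
      Polynomial.eval_map, Polynomial.eval₂_finsetProd, Finset.prod_eq_zero_iff] at hk
    obtain ⟨i, -, hi⟩ := hk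
    have : k = (hTH.eigenvalues i : ℂ) := by
      simpa [sub_eq_zero] using hi
    rw [this]
    have := hr i
    simpa using this

/-! ### Laurent polynomials in exp x. -/

/-- The linear map `Q ↦ exp(-N x) Q(exp x)`. -/
def expEval (N : ℕ) : ℝ[X] →ₗ[ℝ] (ℝ → ℝ) where
  toFun Q x := Real.exp (-(N * x)) * Q.eval (Real.exp x)
  map_add' P Q := by ext x; simp [mul_add]
  map_smul' c P := by ext x; simp; ring

/-- The Laurent polynomials in `exp x` with exponents between `-N` and `N`. -/
def laurent (N : ℕ) : Submodule ℝ (ℝ → ℝ) :=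
  (Polynomial.degreeLT ℝ (2 * N + 1)).map (expEval N)

theorem mem_laurent {N : ℕ} {f : ℝ → ℝ} : f ∈ laurent N ↔
    ∃ Q : ℝ[X], Q.natDegree ≤ 2 * N ∧ ∀ x, f x = Real.exp (-(N * x)) * Q.eval (Real.exp x) := by
  simp only [laurent, Submodule.mem_map, Polynomial.mem_degreeLT]
  constructor
  · rintro ⟨Q, hQ, rfl⟩
    refine ⟨Q, ?_, fun x => rfl⟩
    rcases eq_or_ne Q 0 with rfl | h0
    · simp
    · rw [Polynomial.degree_eq_natDegree h0] at hQ
      exact Nat.lt_succ_iff.1 (by exact_mod_cast hQ)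
  · rintro ⟨Q, hQ, h⟩
    refine ⟨Q, ?_, funext fun x => (h x).symm⟩
    exact lt_of_le_of_lt (Polynomial.natDegree_le_iff_degree_le.1 hQ) (by exact_mod_cast by omega)

theorem laurent_mul {M N : ℕ} {f g : ℝ → ℝ} (hf : f ∈ laurent M) (hg : g ∈ laurent N) :
    (fun x => f x * g x) ∈ laurent (M + N) := by
  obtain ⟨P, hP, h⟩ := mem_laurent.1 hf
  obtain ⟨Q, hQ, h'⟩ := mem_laurent.1 hg
  refine mem_laurent.2 ⟨P * Q, ?_, fun x => ?_⟩
  · have := Polynomial.natDegree_mul_le (p := P) (q := Q); omega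
  · rw [h, h', Polynomial.eval_mul]
    have : Real.exp (-(((M + N : ℕ) : ℝ) * x)) = Real.exp (-(M * x)) * Real.exp (-(N * x)) := by
      rw [← Real.exp_add]; congr 1; push_cast; ring
    rw [this]; ring

theorem const_mem_laurent (c : ℝ) : (fun _ => c) ∈ laurent 0 :=
  mem_laurent.2 ⟨C c, by simp, fun x => by simp⟩

theorem laurent_mono {M N : ℕ} (h : M ≤ N) : laurent M ≤ laurent N := by
  intro f hf
  obtain ⟨P, hP, h'⟩ := mem_laurent.1 hf
  refine mem_laurent.2 ⟨P * X ^ (N - M), ?_, fun x => ?_⟩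
  · have := Polynomial.natDegree_mul_le (p := P) (q := X ^ (N - M))
    have := Polynomial.natDegree_X_pow_le (R := ℝ) (N - M)
    omega
  · rw [h', Polynomial.eval_mul, Polynomial.eval_pow, Polynomial.eval_X, ← Real.exp_nat_mul]
    have : Real.exp (-((M : ℝ) * x)) = Real.exp (-(N * x)) * Real.exp (((N - M : ℕ) : ℝ) * x) := by
      rw [← Real.exp_add, Nat.cast_sub h]; congr 1; ring
    rw [this]; ring

theorem cosh_mem_laurent : Real.cosh ∈ laurent 1 := by
  refine mem_laurent.2 ⟨C (1 / 2) * (X ^ 2 + 1), by compute_degree, fun x => ?_⟩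
  have h : Real.exp (-x) * Real.exp x = 1 := by rw [← Real.exp_add]; simp
  simp only [Real.cosh_eq, eval_mul, eval_C, eval_add, eval_pow, eval_X, eval_one, Nat.cast_one,
    one_mul]
  linear_combination -(1 / 2) * Real.exp x * h

theorem sinh_mem_laurent : Real.sinh ∈ laurent 1 := by
  refine mem_laurent.2 ⟨C (1 / 2) * (X ^ 2 - 1), by compute_degree, fun x => ?_⟩
  have h : Real.exp (-x) * Real.exp x = 1 := by rw [← Real.exp_add]; simp
  simp only [Real.sinh_eq, eval_mul, eval_C, eval_sub, eval_pow, eval_X, eval_one, Nat.cast_one,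
    one_mul]
  linear_combination -(1 / 2) * Real.exp x * h

theorem cosh_add_mem_laurent (y : ℝ) : (fun x => Real.cosh (x + y)) ∈ laurent 1 := by
  have h := Submodule.add_mem _ (Submodule.smul_mem _ (Real.cosh y) cosh_mem_laurent)
    (Submodule.smul_mem _ (Real.sinh y) sinh_mem_laurent)
  convert! h using 1
  ext x
  simp only [Real.cosh_add, Pi.add_apply, Pi.smul_apply, smul_eq_mul]; ring

theorem sinh_add_mem_laurent (y : ℝ) : (fun x => Real.sinh (x + y)) ∈ laurent 1 := by
  have h := Submodule.add_mem _ (Submodule.smul_mem _ (Real.sinh y) cosh_mem_laurent)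
    (Submodule.smul_mem _ (Real.cosh y) sinh_mem_laurent)
  convert! h using 1
  ext x
  simp only [Real.sinh_add, Pi.add_apply, Pi.smul_apply, smul_eq_mul]; ring

theorem cosh_pow_mem_laurent (n : ℕ) : (fun x => Real.cosh x ^ n) ∈ laurent n := by
  induction n with
  | zero => simpa using const_mem_laurent 1
  | succ n ih => simpa only [pow_succ] using laurent_mul ih cosh_mem_laurent

theorem eval_cosh_mem_laurent {P : ℝ[X]} {n : ℕ} (h : P.natDegree ≤ n) :
    (fun x => P.eval (Real.cosh x)) ∈ laurent n := by
  have : (fun x => P.eval (Real.cosh x)) =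
      ∑ i ∈ Finset.range (n + 1), P.coeff i • fun x => Real.cosh x ^ i := by
    ext x
    simp [Polynomial.eval_eq_sum_range' (Nat.lt_succ_of_le h)]
  rw [this]
  refine Submodule.sum_mem _ fun i hi => Submodule.smul_mem _ _ ?_
  exact laurent_mono (by have := Finset.mem_range.1 hi; omega) (cosh_pow_mem_laurent i)

theorem laurent_continuous {N : ℕ} {f : ℝ → ℝ} (hf : f ∈ laurent N) : Continuous f := by
  obtain ⟨Q, -, h⟩ := mem_laurent.1 hf
  rw [funext h]
  exact (by fun_prop : Continuous fun x : ℝ => Real.exp (-(N * x))).mul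
    (Q.continuous.comp Real.continuous_exp)

theorem laurent_hasDerivAt {N : ℕ} {f : ℝ → ℝ} (hf : f ∈ laurent N) :
    ∃ f' ∈ laurent N, ∀ x, HasDerivAt f (f' x) x := by
  obtain ⟨Q, hQ, h⟩ := mem_laurent.1 hf
  rw [funext h]
  refine ⟨_, mem_laurent.2 ⟨C (-(N : ℝ)) * Q + X * derivative Q, ?_, fun x => rfl⟩, fun x => ?_⟩
  · refine Polynomial.natDegree_add_le_of_degree_le
      ((Polynomial.natDegree_C_mul_le _ _).trans hQ) ?_
    rcases Nat.eq_zero_or_pos Q.natDegree with h0 | h0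
    · rw [Polynomial.derivative_of_natDegree_zero h0]; simp
    · have h1 := Polynomial.natDegree_mul_le (p := X) (q := derivative Q)
      have h2 := Polynomial.natDegree_derivative_lt h0.ne'
      have h3 := Polynomial.natDegree_X_le (R := ℝ)
      omega
  · have h1 : HasDerivAt (fun x : ℝ => Real.exp (-(N * x)))
        (Real.exp (-(N * x)) * (-(N * 1))) x :=
      (((hasDerivAt_id x).const_mul (N : ℝ)).neg).exp
    have h2 := (Q.hasDerivAt (Real.exp x)).comp x (Real.hasDerivAt_exp x)
    refine (h1.mul h2).congr_deriv ?_
    simp only [eval_add, eval_mul, eval_C, eval_X, Function.comp]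
    ring

/-- A Laurent polynomial in `exp x` with a zero `x₀` is divisible by `exp x - exp x₀`. -/
theorem laurent_div {N : ℕ} {f : ℝ → ℝ} (hf : f ∈ laurent N) {x₀ : ℝ} (h0 : f x₀ = 0) :
    ∃ g ∈ laurent N, ∀ x, f x = (Real.exp x - Real.exp x₀) * g x := by
  obtain ⟨Q, hQ, h⟩ := mem_laurent.1 hf
  have hr : Q.IsRoot (Real.exp x₀) := by
    rw [h] at h0
    exact (mul_eq_zero.1 h0).resolve_left (Real.exp_ne_zero _)
  obtain ⟨R, hR⟩ := Polynomial.dvd_iff_isRoot.2 hr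
  refine ⟨_, mem_laurent.2 ⟨R, ?_, fun x => rfl⟩, fun x => ?_⟩
  · rcases eq_or_ne R 0 with rfl | hR0
    · simp
    · rw [hR, Polynomial.natDegree_mul (Polynomial.X_sub_C_ne_zero _) hR0,
        Polynomial.natDegree_X_sub_C] at hQ
      omega
  · rw [h, hR]; simp only [eval_mul, eval_sub, eval_X, eval_C]; ring

/-- The upper bound suffices: together with 2N+1 independent modes it forces these to span. -/
theorem finrank_laurent_le (N : ℕ) :
    FiniteDimensional ℝ (laurent N) ∧ Module.finrank ℝ (laurent N) ≤ 2 * N + 1 := by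
  have e := Polynomial.degreeLTEquiv ℝ (2 * N + 1)
  have : FiniteDimensional ℝ (Polynomial.degreeLT ℝ (2 * N + 1)) :=
    Module.Finite.equiv e.symm
  refine ⟨inferInstanceAs (FiniteDimensional ℝ ((degreeLT ℝ (2 * N + 1)).map (expEval N))), ?_⟩
  refine (Submodule.finrank_map_le (expEval N) (degreeLT ℝ (2 * N + 1))).trans ?_
  rw [e.finrank_eq]; simp

/-! ### Integration against exp(−ζ cosh x). -/

theorem sq_div_four_le_cosh (x : ℝ) : x ^ 2 / 4 ≤ Real.cosh x := by
  rw [← Real.cosh_abs, Real.cosh_eq, ← sq_abs]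
  have h1 := Real.quadratic_le_exp_of_nonneg (abs_nonneg x)
  have h2 := Real.add_one_le_exp (-|x|)
  linarith

theorem exp_mul_integrable (k : ℝ) {ζ : ℝ} (hζ : 0 < ζ) :
    Integrable fun x : ℝ => Real.exp (k * x) * Real.exp (-ζ * Real.cosh x) := by
  -- Half of the decay −ζx²/4 obtained from cosh x ≥ x²/4 absorbs the linear term kx after
  -- completing the square; the other half is the Gaussian majorant.
  have h := (integrable_exp_neg_mul_sq (b := ζ / 8) (by positivity)).const_mul 
    (Real.exp (2 * k ^ 2 / ζ))
  refine h.mono' (Continuous.aestronglyMeasurable (by fun_prop)) (ae_of_all _ fun x => ?_)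
  rw [Real.norm_eq_abs, abs_of_pos (by positivity), ← Real.exp_add, ← Real.exp_add]
  apply Real.exp_le_exp.2
  have h1 := mul_le_mul_of_nonneg_left (sq_div_four_le_cosh x) hζ.le
  have h2 : k * x ≤ 2 * k ^ 2 / ζ + ζ / 8 * x ^ 2 := by
    have : 0 ≤ 2 * (k - ζ / 4 * x) ^ 2 / ζ := by positivity
    have h3 : 2 * (k - ζ / 4 * x) ^ 2 / ζ = 2 * k ^ 2 / ζ - k * x + ζ / 8 * x ^ 2 := by
      field_simp; ring
    linarith
  linarith

theorem laurent_integrable {N : ℕ} {f : ℝ → ℝ} (hf : f ∈ laurent N) {ζ : ℝ} (hζ : 0 < ζ) :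
    Integrable fun x => f x * Real.exp (-ζ * Real.cosh x) := by
  obtain ⟨Q, hQ, h⟩ := mem_laurent.1 hf
  have : (fun x => f x * Real.exp (-ζ * Real.cosh x)) = fun x =>
      ∑ i ∈ Finset.range (Q.natDegree + 1), Q.coeff i *
        (Real.exp ((i - N : ℝ) * x) * Real.exp (-ζ * Real.cosh x)) := by
    ext x
    rw [h, Polynomial.eval_eq_sum_range, Finset.mul_sum, Finset.sum_mul]
    refine Finset.sum_congr rfl fun i _ => ?_
    have : Real.exp ((i - N : ℝ) * x) = Real.exp (-(N * x)) * Real.exp x ^ i := by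
      rw [← Real.exp_nat_mul, ← Real.exp_add]; congr 1; ring
    rw [this]; ring
  rw [this]
  exact integrable_finsetSum _ fun i _ => (exp_mul_integrable _ hζ).const_mul _

/-- The integral of `f` with the weight `exp(-ζ cosh x)`. -/
def wint (ζ : ℝ) (f : ℝ → ℝ) : ℝ := ∫ x, f x * Real.exp (-ζ * Real.cosh x)

theorem wint_add {M N : ℕ} {f g : ℝ → ℝ} (hf : f ∈ laurent M) (hg : g ∈ laurent N) {ζ : ℝ}
    (hζ : 0 < ζ) : wint ζ (fun x => f x + g x) = wint ζ f + wint ζ g := by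
  simp only [wint, add_mul]
  exact integral_add (laurent_integrable hf hζ) (laurent_integrable hg hζ)

theorem wint_sub {M N : ℕ} {f g : ℝ → ℝ} (hf : f ∈ laurent M) (hg : g ∈ laurent N) {ζ : ℝ}
    (hζ : 0 < ζ) : wint ζ (fun x => f x - g x) = wint ζ f - wint ζ g := by
  simp only [wint, sub_mul]
  exact integral_sub (laurent_integrable hf hζ) (laurent_integrable hg hζ)

theorem wint_const_mul (c ζ : ℝ) (f : ℝ → ℝ) : wint ζ (fun x => c * f x) = c * wint ζ f := by
  simp only [wint, mul_assoc]
  exact integral_const_mul _ _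

theorem wint_sum {ι : Type*} (s : Finset ι) {N : ℕ} {f : ι → ℝ → ℝ} (hf : ∀ i ∈ s, f i ∈ laurent N)
    {ζ : ℝ} (hζ : 0 < ζ) : wint ζ (fun x => ∑ i ∈ s, f i x) = ∑ i ∈ s, wint ζ (f i) := by
  simp only [wint, Finset.sum_mul]
  exact integral_finsetSum _ fun i hi => laurent_integrable (hf i hi) hζ

/-- A continuous integrand that is nonzero somewhere has open nonempty support, hence support of
positive measure. -/
theorem wint_pos {N : ℕ} {f : ℝ → ℝ} (hf : f ∈ laurent N) (h0 : ∀ x, 0 ≤ f x) {x₀ : ℝ}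
    (hx : f x₀ ≠ 0) {ζ : ℝ} (hζ : 0 < ζ) : 0 < wint ζ f := by
  have hc : Continuous fun x => f x * Real.exp (-ζ * Real.cosh x) :=
    (laurent_continuous hf).mul (by fun_prop)
  refine (integral_pos_iff_support_of_nonneg (fun x => mul_nonneg (h0 x) (Real.exp_pos _).le)
    (laurent_integrable hf hζ)).2 ?_
  exact hc.isOpen_support.measure_pos _ ⟨x₀, mul_ne_zero hx (Real.exp_ne_zero _)⟩

theorem wint_odd {f : ℝ → ℝ} (hf : ∀ x, f (-x) = -f x) (ζ : ℝ) : wint ζ f = 0 := by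
  have h := integral_neg_eq_self (fun x => f x * Real.exp (-ζ * Real.cosh x)) volume
  simp only [hf, Real.cosh_neg, neg_mul, integral_neg] at h
  simp only [wint, neg_mul]
  linarith

theorem wint_cosh_pos {ζ : ℝ} (hζ : 0 < ζ) : 0 < wint ζ Real.cosh :=
  wint_pos cosh_mem_laurent (fun x => (Real.cosh_pos x).le) (x₀ := 0) (by simp) hζ

theorem wint_hasDerivAt {N : ℕ} {f : ℝ → ℝ} (hf : f ∈ laurent N) {ζ : ℝ} (hζ : 0 < ζ) :
    HasDerivAt (fun z => wint z f) (-wint ζ (fun x => Real.cosh x * f x)) ζ := by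
  have hcf := laurent_mul cosh_mem_laurent hf
  have hc := laurent_continuous hf
  have key := hasDerivAt_integral_of_dominated_loc_of_deriv_le
    (F := fun z x => f x * Real.exp (-z * Real.cosh x))
    (F' := fun z x => -(Real.cosh x * f x * Real.exp (-z * Real.cosh x))) (μ := volume)
    -- For z > ζ/2 the weight is at most the one with parameter ζ/2, which still gives an integrable
    -- majorant.
    (bound := fun x => ‖Real.cosh x * f x * Real.exp (-(ζ / 2) * Real.cosh x)‖)
    (s := Set.Ioi (ζ / 2)) (x₀ := ζ) (Ioi_mem_nhds (by linarith))
    (Filter.Eventually.of_forall fun z => (hc.mul (by fun_prop)).aestronglyMeasurable)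
    (laurent_integrable hf hζ)
    ((((Real.continuous_cosh.mul hc).mul (by fun_prop)).neg).aestronglyMeasurable)
    (ae_of_all _ fun x z hz => ?_) (laurent_integrable hcf (half_pos hζ)).norm
    (ae_of_all _ fun x z hz => ?_)
  · have := key.2
    rwa [integral_neg] at this
  · rw [norm_neg, norm_mul, norm_mul _ (Real.exp _), Real.norm_of_nonneg (Real.exp_pos _).le,
      Real.norm_of_nonneg (Real.exp_pos _).le]
    refine mul_le_mul_of_nonneg_left (Real.exp_le_exp.2 ?_) (norm_nonneg _)
    have := Real.cosh_pos x
    have hz' : ζ / 2 < z := hz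
    nlinarith
  · have h1 : HasDerivAt (fun z : ℝ => Real.exp (-z * Real.cosh x))
        (Real.exp (-z * Real.cosh x) * (-1 * Real.cosh x)) z :=
      (((hasDerivAt_id z).neg).mul_const _).exp
    exact (h1.const_mul (f x)).congr_deriv (by ring)

/-- Integration by parts against the weight. -/
theorem integral_deriv_weight_mul {M N : ℕ} {f f' r r' : ℝ → ℝ} (hf : f ∈ laurent M)
    (hf' : ∀ x, HasDerivAt f (f' x) x) (hf'm : f' ∈ laurent M) (hr : r ∈ laurent N)
    (hr' : ∀ x, HasDerivAt r (r' x) x) (hr'm : r' ∈ laurent N) {ζ : ℝ} (hζ : 0 < ζ) :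
    ∫ x, (f' x - ζ * Real.sinh x * f x) * Real.exp (-ζ * Real.cosh x) * r x =
      -wint ζ (fun x => f x * r' x) := by
  have hE : ∀ x, HasDerivAt (fun x => f x * Real.exp (-ζ * Real.cosh x))
      ((f' x - ζ * Real.sinh x * f x) * Real.exp (-ζ * Real.cosh x)) x := by
    intro x
    have h1 : HasDerivAt (fun x => Real.exp (-ζ * Real.cosh x))
        (Real.exp (-ζ * Real.cosh x) * (-ζ * Real.sinh x)) x :=
      ((Real.hasDerivAt_cosh x).const_mul _).exp
    exact ((hf' x).mul h1).congr_deriv (by ring)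
  have hm : (fun x => f' x - ζ * Real.sinh x * f x) ∈ laurent (1 + M) := by
    have h1 := laurent_mono (show M ≤ 1 + M by omega) hf'm
    have h2 := laurent_mul sinh_mem_laurent hf
    convert! Submodule.sub_mem _ h1 (Submodule.smul_mem _ ζ h2) using 1
    ext x; simp only [Pi.sub_apply, Pi.smul_apply, smul_eq_mul]; ring
  have key := integral_mul_deriv_eq_deriv_mul_of_integrable
    (u := r) (v := fun x => f x * Real.exp (-ζ * Real.cosh x))
    (fun x _ => hr' x) (fun x _ => hE x) ?_ ?_ ?_
  · rw [wint, ← integral_neg]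
    rw [← integral_neg] at key
    convert! key using 3 <;> ring
  · convert! laurent_integrable (laurent_mul hr hm) hζ using 1
    ext x; simp only [Pi.mul_apply]; ring
  · convert! laurent_integrable (laurent_mul hr'm hf) hζ using 1
    ext x; simp only [Pi.mul_apply]; ring
  · convert! laurent_integrable (laurent_mul hr hf) hζ using 1
    ext x; simp only [Pi.mul_apply]; ring

theorem wint_sum_mul {ι : Type*} (s : Finset ι) {N : ℕ} (c : ι → ℝ) {f : ι → ℝ → ℝ}
    (hf : ∀ i ∈ s, f i ∈ laurent N) {ζ : ℝ} (hζ : 0 < ζ) :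
    wint ζ (fun x => ∑ i ∈ s, c i * f i x) = ∑ i ∈ s, c i * wint ζ (f i) := by
  rw [wint_sum s (N := N) (f := fun i x => c i * f i x)
    (fun i hi => Submodule.smul_mem _ (c i) (hf i hi)) hζ]
  simp only [wint_const_mul]

/-! ### The substitution x = cosh t in the polynomial inner products. -/

theorem wint_even {f : ℝ → ℝ} (hf : ∀ x, f |x| = f x) (ζ : ℝ) :
    wint ζ f = 2 * ∫ x in Set.Ioi (0 : ℝ), f x * Real.exp (-ζ * Real.cosh x) := by
  rw [← integral_comp_abs (f := fun x => f x * Real.exp (-ζ * Real.cosh x))]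
  simp only [hf, Real.cosh_abs, wint]

theorem two_mul_besselK_one (ζ : ℝ) : 2 * besselK 1 ζ = wint ζ Real.cosh := by
  rw [wint_even (fun x => Real.cosh_abs x), besselK]
  simp only [Nat.cast_one, one_mul]

theorem cosh_image_Ioi : Real.cosh '' Set.Ioi 0 = Set.Ioi 1 := by
  ext y
  constructor
  · rintro ⟨x, hx, rfl⟩
    exact Real.one_lt_cosh.2 (ne_of_gt hx)
  · intro hy
    exact ⟨Real.arcosh y, Real.arcosh_pos hy, Real.cosh_arcosh (le_of_lt hy)⟩

/-- With x = cosh t, the measure (x²−1)^{ℓ−1/2} dx becomes sinh^{2ℓ} t dt. This integral and K₁ are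
both half-line integrals of even functions, so passing to the whole line doubles both and the
quotient is unchanged. -/
theorem polyInner_eq (l : ℕ) (ζ : ℝ) (P Q : ℝ[X]) : polyInner l ζ P Q =
    wint ζ (fun x => P.eval (Real.cosh x) * Q.eval (Real.cosh x) * Real.sinh x ^ (2 * l)) /
      wint ζ Real.cosh := by
  rw [wint_even (fun x => by rw [Real.cosh_abs, pow_mul, pow_mul, Real.sinh_sq, Real.sinh_sq,
    Real.cosh_abs]), polyInner, ← cosh_image_Ioi,
    integral_image_eq_integral_abs_deriv_smul measurableSet_Ioi
      (fun x _ => (Real.hasDerivAt_cosh x).hasDerivWithinAt)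
      (Real.cosh_injOn.mono Set.Ioi_subset_Ici_self), ← two_mul_besselK_one,
    mul_div_mul_left _ _ two_ne_zero, ← integral_div]
  refine setIntegral_congr_fun measurableSet_Ioi fun x hx => ?_
  have hs : 0 < Real.sinh x := Real.sinh_pos_iff.2 hx
  have hr : (Real.cosh x ^ 2 - 1) ^ ((l : ℝ) - 1 / 2) * Real.sinh x = Real.sinh x ^ (2 * l) := by
    rw [← Real.sinh_sq, ← Real.rpow_natCast (Real.sinh x) 2, ← Real.rpow_mul hs.le,
      ← Real.rpow_add_one hs.ne', ← Real.rpow_natCast]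
    congr 1; push_cast; ring
  simp only [weight, smul_eq_mul, abs_of_pos hs]
  rw [← hr]; ring

/-! ### Gram–Schmidt orthonormal polynomials. -/

section PolyInner

variable (l : ℕ) {ζ : ℝ}

theorem eval_mul_mem_laurent (P Q : ℝ[X]) :
    ∃ N, (fun x => P.eval (Real.cosh x) * Q.eval (Real.cosh x) * Real.sinh x ^ (2 * l)) ∈
      laurent N := by
  have h : (fun x => P.eval (Real.cosh x) * Q.eval (Real.cosh x) * Real.sinh x ^ (2 * l)) =
      fun x => (P * Q * (X ^ 2 - 1) ^ l).eval (Real.cosh x) := by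
    ext x
    rw [pow_mul, Real.sinh_sq]; simp
  rw [h]
  exact ⟨_, eval_cosh_mem_laurent le_rfl⟩

theorem polyInner_comm (ζ : ℝ) (P Q : ℝ[X]) : polyInner l ζ P Q = polyInner l ζ Q P := by
  simp only [polyInner, mul_comm (eval _ P)]

theorem polyInner_sub_left (hζ : 0 < ζ) (P Q R : ℝ[X]) :
    polyInner l ζ (P - Q) R = polyInner l ζ P R - polyInner l ζ Q R := by
  obtain ⟨N, h⟩ := eval_mul_mem_laurent l P R
  obtain ⟨N', h'⟩ := eval_mul_mem_laurent l Q R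
  rw [polyInner_eq, polyInner_eq, polyInner_eq, ← sub_div, ← wint_sub h h' hζ]
  simp only [eval_sub, sub_mul]

theorem polyInner_add_left (hζ : 0 < ζ) (P Q R : ℝ[X]) :
    polyInner l ζ (P + Q) R = polyInner l ζ P R + polyInner l ζ Q R := by
  obtain ⟨N, h⟩ := eval_mul_mem_laurent l P R
  obtain ⟨N', h'⟩ := eval_mul_mem_laurent l Q R
  rw [polyInner_eq, polyInner_eq, polyInner_eq, ← add_div, ← wint_add h h' hζ]
  simp only [eval_add, add_mul]

theorem polyInner_C_mul_left (ζ c : ℝ) (P R : ℝ[X]) :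
    polyInner l ζ (C c * P) R = c * polyInner l ζ P R := by
  rw [polyInner_eq, polyInner_eq, ← mul_div_assoc, ← wint_const_mul]
  simp only [eval_mul, eval_C, mul_assoc]

theorem polyInner_sum_left (hζ : 0 < ζ) {ι : Type*} (s : Finset ι) (P : ι → ℝ[X]) (R : ℝ[X]) :
    polyInner l ζ (∑ i ∈ s, P i) R = ∑ i ∈ s, polyInner l ζ (P i) R := by
  classical
  induction s using Finset.induction_on with
  | empty => simp [polyInner]
  | insert a s ha ih => rw [Finset.sum_insert ha, Finset.sum_insert ha, polyInner_add_left l hζ, ih]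

theorem polyInner_self_pos (hζ : 0 < ζ) {P : ℝ[X]} (hP : P ≠ 0) : 0 < polyInner l ζ P P := by
  rw [polyInner_eq]
  obtain ⟨N, h⟩ := eval_mul_mem_laurent l P P
  refine div_pos ?_ (wint_cosh_pos hζ)
  obtain ⟨x, hx, hPx⟩ : ∃ x, 0 < x ∧ P.eval (Real.cosh x) ≠ 0 := by
    by_contra! hc
    refine hP (Polynomial.eq_zero_of_infinite_isRoot P ((Set.Ioi_infinite (1 : ℝ)).mono ?_))
    rw [← cosh_image_Ioi]
    rintro _ ⟨x, hx, rfl⟩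
    exact hc x hx
  refine wint_pos h (fun x => ?_) (x₀ := x) ?_ hζ
  · rw [pow_mul]
    exact mul_nonneg (mul_self_nonneg _) (pow_nonneg (sq_nonneg _) _)
  · exact mul_ne_zero (mul_ne_zero hPx hPx) (pow_ne_zero _ (Real.sinh_pos_iff.2 hx).ne')

/-- The Gram–Schmidt polynomial before normalization. -/
def preOrthoPoly (l : ℕ) (ζ : ℝ) (n : ℕ) : ℝ[X] :=
  X ^ n - ∑ k : Fin n, C (polyInner l ζ (X ^ n) (orthoPoly l ζ k.1)) * orthoPoly l ζ k.1

theorem orthoPoly_eq (ζ : ℝ) (n : ℕ) : orthoPoly l ζ n =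
    C (Real.sqrt (polyInner l ζ (preOrthoPoly l ζ n) (preOrthoPoly l ζ n)))⁻¹ *
      preOrthoPoly l ζ n := by
  rw [orthoPoly]; rfl

theorem orthoPoly_natDegree_le (ζ : ℝ) (n : ℕ) : (orthoPoly l ζ n).natDegree ≤ n := by
  induction n using Nat.strong_induction_on with
  | _ n ih =>
    rw [orthoPoly_eq]
    refine (natDegree_C_mul_le _ _).trans ?_
    refine (natDegree_sub_le_of_le (natDegree_X_pow_le n) (natDegree_sum_le_of_forall_le
      (n := n) _ _ ?_)).trans (max_self n).le
    intro k _
    exact (natDegree_C_mul_le _ _).trans ((ih k k.2).trans k.2.le)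

theorem preOrthoPoly_coeff (ζ : ℝ) (n : ℕ) : (preOrthoPoly l ζ n).coeff n = 1 := by
  rw [preOrthoPoly, coeff_sub, coeff_X_pow_self, finsetSum_coeff, Finset.sum_eq_zero, sub_zero]
  intro k _
  rw [coeff_C_mul, coeff_eq_zero_of_natDegree_lt ((orthoPoly_natDegree_le l ζ k).trans_lt k.2),
    mul_zero]

theorem preOrthoPoly_ne_zero (ζ : ℝ) (n : ℕ) : preOrthoPoly l ζ n ≠ 0 := by
  intro h
  have := preOrthoPoly_coeff l ζ n
  simp [h] at this

theorem orthoPoly_coeff_pos (hζ : 0 < ζ) (n : ℕ) : 0 < (orthoPoly l ζ n).coeff n := by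
  rw [orthoPoly_eq, coeff_C_mul, preOrthoPoly_coeff, mul_one, inv_pos]
  exact Real.sqrt_pos.2 (polyInner_self_pos l hζ (preOrthoPoly_ne_zero l ζ n))

theorem polyInner_orthoPoly_self (hζ : 0 < ζ) (n : ℕ) :
    polyInner l ζ (orthoPoly l ζ n) (orthoPoly l ζ n) = 1 := by
  have hpos := polyInner_self_pos l hζ (preOrthoPoly_ne_zero l ζ n)
  rw [orthoPoly_eq, polyInner_C_mul_left, polyInner_comm l ζ (preOrthoPoly l ζ n) (C _ * _),
    polyInner_C_mul_left, ← mul_assoc,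
    ← mul_inv, Real.mul_self_sqrt hpos.le, inv_mul_cancel₀ hpos.ne']

theorem polyInner_orthoPoly_lt (hζ : 0 < ζ) {m n : ℕ} (h : m < n) :
    polyInner l ζ (orthoPoly l ζ n) (orthoPoly l ζ m) = 0 := by
  induction n using Nat.strong_induction_on generalizing m with
  | _ n ih =>
    suffices hpre : polyInner l ζ (preOrthoPoly l ζ n) (orthoPoly l ζ m) = 0 by
      rw [orthoPoly_eq, polyInner_C_mul_left, hpre, mul_zero]
    rw [preOrthoPoly, polyInner_sub_left l hζ, polyInner_sum_left l hζ,
      Finset.sum_eq_single (⟨m, h⟩ : Fin n), polyInner_C_mul_left,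
      polyInner_orthoPoly_self l hζ, mul_one, sub_self]
    · intro k _ hk
      rw [polyInner_C_mul_left]
      have hkm : k.1 ≠ m := fun he => hk (Fin.ext he)
      rcases lt_or_gt_of_ne hkm with hlt | hgt
      · rw [polyInner_comm l ζ _ (orthoPoly l ζ m), ih m h hlt, mul_zero]
      · rw [ih k.1 k.2 hgt, mul_zero]
    · simp

theorem polyInner_orthoPoly (hζ : 0 < ζ) (m n : ℕ) :
    polyInner l ζ (orthoPoly l ζ m) (orthoPoly l ζ n) = if m = n then 1 else 0 := by
  split_ifs with h
  · rw [h, polyInner_orthoPoly_self l hζ]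
  · rcases lt_or_gt_of_ne h with h | h
    · rw [polyInner_comm, polyInner_orthoPoly_lt l hζ h]
    · exact polyInner_orthoPoly_lt l hζ h

end PolyInner

/-! ### The modes as an orthonormal basis of Laurent polynomials. -/

/-- The `i`-th basis function divided by the equilibrium weight, as a function of the rapidity
relative to the mean velocity. -/
def mode (ζ : ℝ) (i : ℕ) (x : ℝ) : ℝ :=
  if i = 0 ∨ i % 2 = 1 then (orthoPoly 0 ζ ((i + 1) / 2)).eval (Real.cosh x)
  else -((orthoPoly 1 ζ (i / 2 - 1)).eval (Real.cosh x) * Real.sinh x)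

theorem mode_mem_laurent (ζ : ℝ) {M i : ℕ} (hi : i < 2 * M + 1) : mode ζ i ∈ laurent M := by
  by_cases h : i = 0 ∨ i % 2 = 1
  · have := eval_cosh_mem_laurent ((orthoPoly_natDegree_le 0 ζ ((i + 1) / 2)).trans
      (show (i + 1) / 2 ≤ M by omega))
    convert! this using 1
    ext x; rw [mode, if_pos h]
  · have h1 := laurent_mul (eval_cosh_mem_laurent (orthoPoly_natDegree_le 1 ζ (i / 2 - 1)))
      sinh_mem_laurent
    have h2 := laurent_mono (show i / 2 - 1 + 1 ≤ M by omega) h1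
    convert! Submodule.neg_mem _ h2 using 1
    ext x; rw [mode, if_neg h]; rfl

/-- Modes of different parity in x are orthogonal by oddness. For equal parity this is the
orthonormality of the polynomials with ℓ = 0 or ℓ = 1; in the latter case the two factors sinh
supply the sinh² of the weight. -/
theorem wint_mode_mul_mode {ζ : ℝ} (hζ : 0 < ζ) (i j : ℕ) :
    wint ζ (fun x => mode ζ i x * mode ζ j x) / wint ζ Real.cosh = if i = j then 1 else 0 := by
  by_cases hi : i = 0 ∨ i % 2 = 1 <;> by_cases hj : j = 0 ∨ j % 2 = 1
  · have h := polyInner_orthoPoly 0 hζ ((i + 1) / 2) ((j + 1) / 2)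
    rw [polyInner_eq] at h
    simp only [mul_zero, pow_zero, mul_one] at h
    simp only [mode, if_pos hi, if_pos hj]
    rw [h]
    congr 1
    apply propext; omega
  · rw [if_neg (by rintro rfl; exact hj hi), wint_odd, zero_div]
    intro x
    simp only [mode, if_pos hi, if_neg hj, Real.cosh_neg, Real.sinh_neg]; ring
  · rw [if_neg (by rintro rfl; exact hi hj), wint_odd, zero_div]
    intro x
    simp only [mode, if_pos hj, if_neg hi, Real.cosh_neg, Real.sinh_neg]; ring
  · have h := polyInner_orthoPoly 1 hζ (i / 2 - 1) (j / 2 - 1)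
    rw [polyInner_eq] at h
    simp only [mode, if_neg hi, if_neg hj]
    have he : (i = j) = (i / 2 - 1 = j / 2 - 1) := by apply propext; omega
    simp only [he]
    rw [← h]
    congr 2
    ext x; ring

theorem mode_linearIndependent {ζ : ℝ} (hζ : 0 < ζ) (M : ℕ) :
    LinearIndependent ℝ fun i : Fin (2 * M + 1) => mode ζ i := by
  rw [Fintype.linearIndependent_iff]
  intro c hc j
  have h1 : (fun x => ∑ i : Fin (2 * M + 1), c i * (mode ζ i x * mode ζ j x)) = fun _ => 0 := by
    ext x
    have := congrFun hc x
    simp only [Finset.sum_apply, Pi.smul_apply, smul_eq_mul, Pi.zero_apply] at this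
    simp only [← mul_assoc]
    rw [← Finset.sum_mul, this, zero_mul]
  have h2 := congrArg (fun f => wint ζ f / wint ζ Real.cosh) h1
  rw [wint_sum_mul _ (N := M + M) c (f := fun i x => mode ζ i x * mode ζ j x) (fun i _ =>
    laurent_mul (mode_mem_laurent ζ i.2) (mode_mem_laurent ζ j.2)) hζ] at h2
  simp only [Finset.sum_div, mul_div_assoc, wint_mode_mul_mode hζ] at h2
  simpa [wint, Fin.val_inj] using h2

theorem span_mode {ζ : ℝ} (hζ : 0 < ζ) (M : ℕ) :
    Submodule.span ℝ (Set.range fun i : Fin (2 * M + 1) => mode ζ i) = laurent M := by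
  obtain ⟨hfd, hrank⟩ := finrank_laurent_le M
  refine Submodule.eq_of_le_of_finrank_le ?_ ?_
  · rw [Submodule.span_le]
    rintro _ ⟨i, rfl⟩
    exact mode_mem_laurent ζ i.2
  · rw [finrank_span_eq_card (mode_linearIndependent hζ M), Fintype.card_fin]
    exact hrank

theorem exists_sum_mode {ζ : ℝ} (hζ : 0 < ζ) {M : ℕ} {f : ℝ → ℝ} (hf : f ∈ laurent M) :
    ∃ c : Fin (2 * M + 1) → ℝ, ∀ x, f x = ∑ i, c i * mode ζ i x := by
  rw [← span_mode hζ, Submodule.mem_span_range_iff_exists_fun] at hf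
  obtain ⟨c, hc⟩ := hf
  refine ⟨c, fun x => ?_⟩
  rw [← hc]; simp

/-! ### Compressed multiplication operators and the kernels of their pencil. -/

/-- The matrix of the multiplication by `a`, compressed to the span of the first modes. -/
def gram (M : ℕ) (ζ : ℝ) (a : ℝ → ℝ) : Matrix (Fin (2 * M + 1)) (Fin (2 * M + 1)) ℝ :=
  Matrix.of fun k i => wint ζ (fun x => a x * mode ζ i x * mode ζ k x) / wint ζ Real.cosh

/-- The linear combination of modes with the given coefficients. -/
def modeSum {M : ℕ} (ζ : ℝ) (c : Fin (2 * M + 1) → ℝ) (x : ℝ) : ℝ := ∑ i, c i * mode ζ i x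

theorem modeSum_mem_laurent {M : ℕ} (ζ : ℝ) (c : Fin (2 * M + 1) → ℝ) :
    modeSum ζ c ∈ laurent M := by
  have : modeSum ζ c = ∑ i, c i • mode ζ i := by ext x; simp [modeSum]
  rw [this]
  exact Submodule.sum_mem _ fun i _ => Submodule.smul_mem _ _ (mode_mem_laurent ζ i.2)

theorem modeSum_ne_zero {M : ℕ} {ζ : ℝ} (hζ : 0 < ζ) {c : Fin (2 * M + 1) → ℝ} (hc : c ≠ 0) :
    ∃ x, modeSum ζ c x ≠ 0 := by
  by_contra! h
  apply hc
  ext i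
  refine Fintype.linearIndependent_iff.1 (mode_linearIndependent hζ M) c ?_ i
  ext x
  simpa [modeSum] using h x

section Gram

variable {M : ℕ} {ζ : ℝ} {a : ℝ → ℝ}

theorem gram_mulVec (hζ : 0 < ζ) (ha : a ∈ laurent 1) (c : Fin (2 * M + 1) → ℝ)
    (k : Fin (2 * M + 1)) : (gram M ζ a).mulVec c k =
      wint ζ (fun x => a x * modeSum ζ c x * mode ζ k x) / wint ζ Real.cosh := by
  have h : (fun x => a x * modeSum ζ c x * mode ζ k x) =
      fun x => ∑ i, c i * (a x * mode ζ i x * mode ζ k x) := by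
    ext x
    rw [modeSum, Finset.mul_sum, Finset.sum_mul]
    exact Finset.sum_congr rfl fun i _ => by ring
  rw [h, wint_sum_mul _ (N := 1 + M + M) c (f := fun i x => a x * mode ζ i x * mode ζ k x)
    (fun i _ => laurent_mul (laurent_mul ha (mode_mem_laurent ζ i.2)) (mode_mem_laurent ζ k.2)) hζ,
    Finset.sum_div]
  simp only [Matrix.mulVec, dotProduct, gram, Matrix.of_apply]
  exact Finset.sum_congr rfl fun i _ => by ring

theorem dotProduct_gram_mulVec (hζ : 0 < ζ) (ha : a ∈ laurent 1) (c d : Fin (2 * M + 1) → ℝ) :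
    d ⬝ᵥ (gram M ζ a).mulVec c =
      wint ζ (fun x => a x * modeSum ζ c x * modeSum ζ d x) / wint ζ Real.cosh := by
  have h : (fun x => a x * modeSum ζ c x * modeSum ζ d x) =
      fun x => ∑ k, d k * (a x * modeSum ζ c x * mode ζ k x) := by
    ext x
    rw [modeSum.eq_1 ζ d, Finset.mul_sum]
    exact Finset.sum_congr rfl fun i _ => by ring
  rw [h, wint_sum_mul _ (N := 1 + M + M) d (f := fun i x => a x * modeSum ζ c x * mode ζ i x)
    (fun i _ => laurent_mul (laurent_mul ha (modeSum_mem_laurent ζ c)) (mode_mem_laurent ζ i.2)) hζ,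
    Finset.sum_div]
  exact Finset.sum_congr rfl fun i _ => by rw [gram_mulVec hζ ha]; ring

theorem gram_isHermitian (M : ℕ) (ζ : ℝ) (a : ℝ → ℝ) : (gram M ζ a).IsHermitian := by
  ext i j
  simp only [Matrix.conjTranspose_apply, gram, Matrix.of_apply, star_trivial]
  congr 2
  ext x; ring

theorem gram_posDef (hζ : 0 < ζ) (ha : a ∈ laurent 1) (hpos : ∀ x, 0 < a x) :
    (gram M ζ a).PosDef := by
  refine Matrix.PosDef.of_dotProduct_mulVec_pos (gram_isHermitian M ζ a) fun {c} hc => ?_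
  rw [star_trivial, dotProduct_gram_mulVec hζ ha]
  refine div_pos ?_ (wint_cosh_pos hζ)
  obtain ⟨x, hx⟩ := modeSum_ne_zero hζ hc
  refine wint_pos (laurent_mul (laurent_mul ha (modeSum_mem_laurent ζ c)) (modeSum_mem_laurent ζ c))
    (fun y => ?_) (x₀ := x) (mul_ne_zero (mul_ne_zero (hpos x).ne' hx) hx) hζ
  rw [mul_assoc]
  exact mul_nonneg (hpos y).le (mul_self_nonneg _)

theorem gram_add (hζ : 0 < ζ) {b : ℝ → ℝ} (ha : a ∈ laurent 1) (hb : b ∈ laurent 1) :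
    gram M ζ a + gram M ζ b = gram M ζ (fun x => a x + b x) := by
  ext k i
  have hm := mode_mem_laurent ζ i.2
  have hm' := mode_mem_laurent ζ k.2
  simp only [gram, Matrix.add_apply, Matrix.of_apply, add_mul]
  rw [wint_add (laurent_mul (laurent_mul ha hm) hm') (laurent_mul (laurent_mul hb hm) hm') hζ,
    add_div]

theorem gram_sub (hζ : 0 < ζ) {b : ℝ → ℝ} (ha : a ∈ laurent 1) (hb : b ∈ laurent 1) :
    gram M ζ a - gram M ζ b = gram M ζ (fun x => a x - b x) := by
  ext k i
  have hm := mode_mem_laurent ζ i.2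
  have hm' := mode_mem_laurent ζ k.2
  simp only [gram, Matrix.sub_apply, Matrix.of_apply, sub_mul]
  rw [wint_sub (laurent_mul (laurent_mul ha hm) hm') (laurent_mul (laurent_mul hb hm) hm') hζ,
    sub_div]

theorem sinh_sub_eq_exp_factor (x x₀ : ℝ) : Real.sinh (x - x₀) =
    (Real.exp x - Real.exp x₀) * ((Real.exp x + Real.exp x₀) *
      Real.exp (-x) * Real.exp (-x₀) / 2) := by
  have h : Real.exp (-x) * Real.exp x = 1 := by rw [← Real.exp_add]; simp
  have h' : Real.exp (-x₀) * Real.exp x₀ = 1 := by rw [← Real.exp_add]; simp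
  rw [Real.sinh_eq, neg_sub, sub_eq_add_neg x, sub_eq_add_neg x₀, Real.exp_add,
    Real.exp_add]
  linear_combination -(1 / 2 : ℝ) * Real.exp x * Real.exp (-x₀) * h +
    (1 / 2 : ℝ) * Real.exp x₀ * Real.exp (-x) * h'

/-- A combination of modes in the kernel of the pencil which vanishes at the zero of the
multiplier is zero. -/
theorem pencil_kernel_eq_zero (hζ : 0 < ζ) {x₀ : ℝ} {c : Fin (2 * M + 1) → ℝ}
    (hc : (gram M ζ fun x => Real.sinh (x - x₀)).mulVec c = 0) (h0 : modeSum ζ c x₀ = 0) :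
    c = 0 := by
  by_contra hne
  obtain ⟨x₁, hx₁⟩ := modeSum_ne_zero hζ hne
  -- The quotient stays in the span of the modes, so it is an allowed test function; sinh(x−x₀)
  -- contributes a second factor exp x − exp x₀, which completes a square.
  obtain ⟨g, hg, hfac⟩ := laurent_div (modeSum_mem_laurent ζ c) h0
  obtain ⟨d, hd⟩ := exists_sum_mode hζ hg
  have hd' : modeSum ζ d = g := funext fun x => (hd x).symm
  have ha := sinh_add_mem_laurent (-x₀)
  simp only [← sub_eq_add_neg] at ha
  have hz := dotProduct_gram_mulVec hζ ha c d
  rw [hc, dotProduct_zero, hd', eq_comm, div_eq_zero_iff] at hz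
  have hz' := hz.resolve_right (wint_cosh_pos hζ).ne'
  refine (wint_pos (laurent_mul (laurent_mul ha (modeSum_mem_laurent ζ c)) hg)
    (fun x => ?_) (x₀ := x₁) ?_ hζ).ne' hz'
  · rw [hfac, sinh_sub_eq_exp_factor]
    have : 0 ≤ ((Real.exp x - Real.exp x₀) * g x) ^ 2 *
        ((Real.exp x + Real.exp x₀) * Real.exp (-x) * Real.exp (-x₀) / 2) := by positivity
    linarith
  · have hg1 : g x₁ ≠ 0 := by rintro h; rw [hfac, h, mul_zero] at hx₁; exact hx₁ rfl
    have hs : Real.sinh (x₁ - x₀) ≠ 0 := by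
      intro h
      rw [Real.sinh_eq_zero, sub_eq_zero] at h
      rw [h] at hx₁
      exact hx₁ h0
    exact mul_ne_zero (mul_ne_zero hs hx₁) hg1

/-- The kernels of the pencil of `cosh (x + y)` and `sinh (x + y)` are at most one-dimensional. -/
theorem pencil_kernel_dim (hζ : 0 < ζ) (y c : ℝ) (v w : Fin (2 * M + 1) → ℝ) (hv0 : v ≠ 0)
    (hv : (gram M ζ fun x => Real.sinh (x + y)).mulVec v =
      c • (gram M ζ fun x => Real.cosh (x + y)).mulVec v)
    (hw : (gram M ζ fun x => Real.sinh (x + y)).mulVec w =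
      c • (gram M ζ fun x => Real.cosh (x + y)).mulVec w) :
    ∃ a b : ℝ, (a ≠ 0 ∨ b ≠ 0) ∧ a • v + b • w = 0 := by
  have hA0 := cosh_add_mem_laurent y
  have hA1 := sinh_add_mem_laurent y
  -- Needed for artanh c, which locates the unique zero x₀ of sinh(x+y) − c cosh(x+y).
  have hc : c ∈ Set.Ioo (-1 : ℝ) 1 := by
    have q0 := (gram_posDef (M := M) hζ hA0 fun x => Real.cosh_pos _).dotProduct_mulVec_pos hv0
    have qp := (gram_posDef (M := M) hζ (Submodule.add_mem _ hA0 hA1) (fun x => by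
      simp only [Pi.add_apply, Real.cosh_add_sinh]; positivity)).dotProduct_mulVec_pos hv0
    have qm := (gram_posDef (M := M) hζ (Submodule.sub_mem _ hA0 hA1) (fun x => by
      simp only [Pi.sub_apply, Real.cosh_sub_sinh]; positivity)).dotProduct_mulVec_pos hv0
    rw [show (gram M ζ ((fun x => Real.cosh (x + y)) + fun x => Real.sinh (x + y))) = _ from
      (gram_add hζ hA0 hA1).symm, Matrix.add_mulVec, dotProduct_add, hv, dotProduct_smul,
      smul_eq_mul] at qp
    rw [show (gram M ζ ((fun x => Real.cosh (x + y)) - fun x => Real.sinh (x + y))) = _ from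
      (gram_sub hζ hA0 hA1).symm, Matrix.sub_mulVec, dotProduct_sub, hv, dotProduct_smul,
      smul_eq_mul] at qm
    constructor <;> nlinarith
  set x₀ := Real.artanh c - y with hx₀
  have hsub := sinh_add_mem_laurent (-x₀)
  simp only [← sub_eq_add_neg] at hsub
  have hsinh : ∀ x, Real.sinh (x - x₀) =
      Real.cosh (Real.artanh c) * (Real.sinh (x + y) - c * Real.cosh (x + y)) := by
    intro x
    have h1 : c * Real.cosh (Real.artanh c) = Real.sinh (Real.artanh c) := by
      nth_rewrite 1 [← Real.tanh_artanh hc]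
      rw [Real.tanh_eq_sinh_div_cosh, div_mul_cancel₀ _ (Real.cosh_pos _).ne']
    rw [show x - x₀ = (x + y) - Real.artanh c by rw [hx₀]; ring, Real.sinh_sub, ← h1]
    ring
  have hker : ∀ v : Fin (2 * M + 1) → ℝ, (gram M ζ fun x => Real.sinh (x + y)).mulVec v =
      c • (gram M ζ fun x => Real.cosh (x + y)).mulVec v →
      (gram M ζ fun x => Real.sinh (x - x₀)).mulVec v = 0 := by
    intro v hv
    ext k
    have hk := congrFun hv k
    rw [Pi.smul_apply, gram_mulVec hζ hA0, gram_mulVec hζ hA1, smul_eq_mul] at hk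
    rw [gram_mulVec hζ hsub]
    have hm := mode_mem_laurent ζ k.2
    have hs := modeSum_mem_laurent ζ v
    have h1 : (fun x => Real.sinh (x - x₀) * modeSum ζ v x * mode ζ k x) = fun x =>
        Real.cosh (Real.artanh c) * (Real.sinh (x + y) * modeSum ζ v x * mode ζ k x -
          c * (Real.cosh (x + y) * modeSum ζ v x * mode ζ k x)) := by
      ext x; rw [hsinh]; ring
    rw [h1, wint_const_mul, wint_sub (laurent_mul (laurent_mul hA1 hs) hm)
      (g := fun x => c * (Real.cosh (x + y) * modeSum ζ v x * mode ζ k x))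
      (Submodule.smul_mem _ c (laurent_mul (laurent_mul hA0 hs) hm)) hζ, wint_const_mul,
      mul_div_assoc, sub_div, hk]
    simp only [Pi.zero_apply]; ring
  have hlin : ∀ a b : ℝ, modeSum ζ (a • v + b • w) x₀ =
      a * modeSum ζ v x₀ + b * modeSum ζ w x₀ := by
    intro a b
    simp only [modeSum, Pi.add_apply, Pi.smul_apply, smul_eq_mul, add_mul, Finset.sum_add_distrib,
      Finset.mul_sum, mul_assoc]
  -- Evaluation at x₀ is injective on the kernel, so the combination of v and w that vanishes at x₀
  -- is zero.
  by_cases hz : modeSum ζ v x₀ = 0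
  · exact ⟨1, 0, Or.inl one_ne_zero, by simp [pencil_kernel_eq_zero hζ (hker v hv) hz]⟩
  · refine ⟨modeSum ζ w x₀, -modeSum ζ v x₀, Or.inr (neg_ne_zero.2 hz), ?_⟩
    refine pencil_kernel_eq_zero hζ ?_ (by rw [hlin]; ring)
    rw [Matrix.mulVec_add, Matrix.mulVec_smul, Matrix.mulVec_smul, hker v hv, hker w hw]
    simp

end Gram

/-! ### Passage to the rapidity relative to the mean velocity. -/

section Rapidity

variable {u : ℝ}

theorem cosh_artanh_eq_U0 (hu : |u| < 1) : Real.cosh (Real.artanh u) = U0 u := by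
  rw [Real.cosh_artanh (abs_lt.1 hu), U0, one_div]

theorem sinh_artanh_eq_U1 (hu : |u| < 1) : Real.sinh (Real.artanh u) = U1 u := by
  rw [Real.sinh_artanh (abs_lt.1 hu), U1, U0, div_eq_mul_inv]

theorem p0_sinh (y : ℝ) : p0 (Real.sinh y) = Real.cosh y := by
  rw [p0, add_comm, ← Real.cosh_sq, Real.sqrt_sq (Real.cosh_pos y).le]

theorem energy_sinh (hu : |u| < 1) (y : ℝ) :
    energy u (Real.sinh y) = Real.cosh (y - Real.artanh u) := by
  rw [energy, p0_sinh, ← cosh_artanh_eq_U0 hu, ← sinh_artanh_eq_U1 hu, Real.cosh_sub]; ring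

theorem pPerp_sinh (hu : |u| < 1) (y : ℝ) :
    pPerp u (Real.sinh y) = -(U0 u * Real.sinh (y - Real.artanh u)) := by
  rw [pPerp, energy_sinh hu, ← cosh_artanh_eq_U0 hu, ← sinh_artanh_eq_U1 hu, Real.cosh_sub,
    Real.sinh_sub]
  linear_combination Real.sinh y * Real.cosh_sq (Real.artanh u)

theorem g0_sinh (hu : |u| < 1) (θ y : ℝ) : g0 u θ (Real.sinh y) =
    Real.exp (-θ⁻¹ * Real.cosh (y - Real.artanh u)) / wint θ⁻¹ Real.cosh := by
  rw [g0, energy_sinh hu, two_mul_besselK_one, div_eq_inv_mul _ θ, neg_mul]; ring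

theorem U0_pos (hu : |u| < 1) : 0 < U0 u := by
  rw [← cosh_artanh_eq_U0 hu]; exact Real.cosh_pos _

theorem basisFn_sinh (hu : |u| < 1) (θ : ℝ) (i : ℕ) (y : ℝ) : basisFn u θ i (Real.sinh y) =
    g0 u θ (Real.sinh y) * mode θ⁻¹ i (y - Real.artanh u) := by
  have := (U0_pos hu).ne'
  by_cases h : i = 0 ∨ i % 2 = 1
  · simp only [basisFn, mode, if_pos h, basisEven, energy_sinh hu]
  · simp only [basisFn, mode, if_neg h, basisOdd, energy_sinh hu, pPerp_sinh hu]
    field_simp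

theorem inner0_eq (u θ y : ℝ) (f h : ℝ → ℝ) : inner0 u θ f h =
    ∫ x, 1 / g0 u θ (Real.sinh (x + y)) * f (Real.sinh (x + y)) * h (Real.sinh (x + y)) := by
  rw [inner0, integral_add_right_eq_self (fun x => 1 / g0 u θ (Real.sinh x) * f (Real.sinh x) *
    h (Real.sinh x)) y]
  have key := integral_image_eq_integral_abs_deriv_smul (s := Set.univ) MeasurableSet.univ
    (fun x _ => (Real.hasDerivAt_sinh x).hasDerivWithinAt) Real.sinh_injective.injOn
    (fun p => 1 / g0 u θ p * f p * h p / p0 p)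
  rw [Set.image_univ, Real.sinh_surjective.range_eq, setIntegral_univ, setIntegral_univ] at key
  rw [key]
  congr 1
  ext x
  have := Real.cosh_pos x
  rw [p0_sinh, abs_of_pos this, smul_eq_mul]
  field_simp

/-- The weight 1/g of the inner product cancels the factor g of the basis function, leaving no
weight. -/
theorem inner0_basisFn (hu : |u| < 1) {θ : ℝ} (hθ : 0 < θ) (f : ℝ → ℝ) (k : ℕ) :
    inner0 u θ f (basisFn u θ k) =
      ∫ x, f (Real.sinh (x + Real.artanh u)) * mode θ⁻¹ k x := by
  rw [inner0_eq u θ (Real.artanh u)]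
  congr 1
  ext x
  have hg : g0 u θ (Real.sinh (x + Real.artanh u)) ≠ 0 := by
    rw [g0_sinh hu]
    exact div_ne_zero (Real.exp_ne_zero _) (wint_cosh_pos (inv_pos.2 hθ)).ne'
  rw [basisFn_sinh hu, add_sub_cancel_right]
  field_simp

/-- The matrix of the partial derivatives of the distribution function. -/
def derivMatrix (M : ℕ) (W : Fin (2 * M + 1) → ℝ) :
    Matrix (Fin (2 * M + 1)) (Fin (2 * M + 1)) ℝ :=
  Matrix.of fun i j => inner0 (velocity W) (temperature W) (distributionDeriv M W j)
    (basisFn (velocity W) (temperature W) i)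

/-- The inner projection replaces ∂F/∂W_j by the combination of basis functions whose coefficients
form column j of `derivMatrix`; multiplying by a and taking coefficients again applies the Gram
matrix of a. -/
theorem momentMatrix_eq {M : ℕ} {W : Fin (2 * M + 1) → ℝ} (hu : |velocity W| < 1)
    (hθ : 0 < temperature W) {a : ℝ → ℝ}
    (ha : (fun x => a (Real.sinh (x + Real.artanh (velocity W)))) ∈ laurent 1) :
    momentMatrix M a W = gram M (temperature W)⁻¹
      (fun x => a (Real.sinh (x + Real.artanh (velocity W)))) * derivMatrix M W := by
  ext k j
  have hζ := inv_pos.2 hθ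
  have hm : (gram M (temperature W)⁻¹
      (fun x => a (Real.sinh (x + Real.artanh (velocity W)))) * derivMatrix M W) k j =
      (gram M (temperature W)⁻¹ (fun x => a (Real.sinh (x + Real.artanh (velocity W))))).mulVec
        (fun i => derivMatrix M W i j) k := rfl
  rw [hm, gram_mulVec hζ ha, momentMatrix, Matrix.of_apply, inner0_basisFn hu hθ, wint,
    ← integral_div]
  congr 1
  ext x
  simp only [proj, basisFn_sinh hu, g0_sinh hu, add_sub_cancel_right, modeSum, derivMatrix,
    Matrix.of_apply]
  simp only [Finset.mul_sum, Finset.sum_mul, Finset.sum_div]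
  exact Finset.sum_congr rfl fun i _ => by ring

end Rapidity

/-- Strict hyperbolicity and the bound for the spectral radius, provided that the matrix of partial
derivatives is invertible. -/
theorem hyperbolic_of_isUnit_derivMatrix {M : ℕ} {W : Fin (2 * M + 1) → ℝ}
    (hu : |velocity W| < 1) (hθ : 0 < temperature W) (hD : IsUnit (derivMatrix M W)) :
    (IsUnit (B0 M W) ∧ ∃ lam : Fin (2 * M + 1) → ℝ, StrictMono lam ∧
      ∀ i, Module.End.HasEigenvalue (Matrix.toLin' ((B0 M W)⁻¹ * B1 M W)) (lam i)) ∧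
    spectralRadius ℂ (((B0 M W)⁻¹ * B1 M W).map (algebraMap ℝ ℂ)) < 1 := by
  have hζ := inv_pos.2 hθ
  have hA0 := cosh_add_mem_laurent (Real.artanh (velocity W))
  have hA1 := sinh_add_mem_laurent (Real.artanh (velocity W))
  have h0 : B0 M W = _ := momentMatrix_eq (a := p0) hu hθ (by simpa only [p0_sinh] using hA0)
  have h1 : B1 M W = _ := momentMatrix_eq (a := fun p => p) hu hθ hA1
  simp only [p0_sinh] at h0
  rw [h0, h1]
  refine pencil_spectrum (gram_posDef hζ hA0 fun x => Real.cosh_pos _) (gram_isHermitian _ _ _)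
    ?_ ?_ hD (pencil_kernel_dim hζ _)
  · rw [gram_add hζ hA0 hA1]
    refine gram_posDef hζ (Submodule.add_mem _ hA0 hA1) fun x => ?_
    rw [Real.cosh_add_sinh]; positivity
  · rw [gram_sub hζ hA0 hA1]
    refine gram_posDef hζ (Submodule.sub_mem _ hA0 hA1) fun x => ?_
    rw [Real.cosh_sub_sinh]; positivity

/-! ### Parameter-dependent families and differentiation under the integral. -/

/-- Families of Laurent polynomials in `exp x` whose coefficients depend on a parameter and are
differentiable at `s₀`. -/
inductive DiffFamily (s₀ : ℝ) : (ℝ → ℝ → ℝ) → Prop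
  | smul (a : ℝ → ℝ) (ha : DifferentiableAt ℝ a s₀) (N : ℕ) (w : ℝ → ℝ) (hw : w ∈ laurent N) :
      DiffFamily s₀ fun s x => a s * w x
  | add (v w : ℝ → ℝ → ℝ) : DiffFamily s₀ v → DiffFamily s₀ w →
      DiffFamily s₀ fun s x => v s x + w s x

namespace DiffFamily

variable {s₀ : ℝ} {v w : ℝ → ℝ → ℝ}

theorem const_mul (hv : DiffFamily s₀ v) {a : ℝ → ℝ} (ha : DifferentiableAt ℝ a s₀) :
    DiffFamily s₀ fun s x => a s * v s x := by
  induction hv with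
  | smul b hb N w hw => simpa only [mul_assoc] using DiffFamily.smul _ (ha.fun_mul hb) N w hw
  | add v w _ _ ihv ihw => simpa only [mul_add] using DiffFamily.add _ _ ihv ihw

theorem mul (hv : DiffFamily s₀ v) (hw : DiffFamily s₀ w) :
    DiffFamily s₀ fun s x => v s x * w s x := by
  induction hv with
  | smul a ha N f hf =>
    induction hw with
    | smul b hb N' g hg =>
      convert! DiffFamily.smul _ (ha.mul hb) _ _ (laurent_mul hf hg) using 3
      simp only [Pi.mul_apply]; ring
    | add v w _ _ ihv ihw => simpa only [mul_add] using DiffFamily.add _ _ ihv ihw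
  | add v w _ _ ihv ihw => simpa only [add_mul] using DiffFamily.add _ _ ihv ihw

theorem sum {ι : Type*} (t : Finset ι) {v : ι → ℝ → ℝ → ℝ} (hv : ∀ i, DiffFamily s₀ (v i)) :
    DiffFamily s₀ fun s x => ∑ i ∈ t, v i s x := by
  classical
  induction t using Finset.induction_on with
  | empty =>
    simpa using DiffFamily.smul (s₀ := s₀) (fun _ => 0) (by fun_prop) 0 _ (const_mem_laurent 1)
  | insert a t ha ih => simpa only [Finset.sum_insert ha] using DiffFamily.add _ _ (hv a) ih

theorem const {N : ℕ} {f : ℝ → ℝ} (hf : f ∈ laurent N) : DiffFamily s₀ fun _ x => f x := by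
  simpa only [one_mul] using DiffFamily.smul (s₀ := s₀) (fun _ => 1) (by fun_prop) N f hf

theorem mem_laurent (hv : DiffFamily s₀ v) : ∃ N, ∀ s, v s ∈ laurent N := by
  induction hv with
  | smul b hb N w hw => exact ⟨N, fun s => Submodule.smul_mem _ _ hw⟩
  | add v w _ _ ihv ihw =>
    obtain ⟨N, h⟩ := ihv
    obtain ⟨N', h'⟩ := ihw
    exact ⟨max N N', fun s => Submodule.add_mem _ (laurent_mono (le_max_left _ _) (h s))
      (laurent_mono (le_max_right _ _) (h' s))⟩

theorem differentiableAt (hv : DiffFamily s₀ v) (x : ℝ) :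
    DifferentiableAt ℝ (fun s => v s x) s₀ := by
  induction hv with
  | smul b hb N w hw => exact hb.mul_const _
  | add v w _ _ ihv ihw => exact ihv.add ihw

theorem differentiableAt_mul_exp (hv : DiffFamily s₀ v) {ζ : ℝ → ℝ} (hd : DifferentiableAt ℝ ζ s₀)
    (x : ℝ) : DifferentiableAt ℝ (fun s => v s x * Real.exp (-ζ s * Real.cosh x)) s₀ :=
  (hv.differentiableAt x).mul ((hd.neg.mul_const _).exp)

/-- Differentiation under the integral sign. -/
theorem hasDerivAt_wint (hv : DiffFamily s₀ v) {ζ : ℝ → ℝ} (hd : DifferentiableAt ℝ ζ s₀)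
    (hζ : 0 < ζ s₀) {N : ℕ} {r : ℝ → ℝ} (hr : r ∈ laurent N) :
    Integrable (fun x => deriv (fun s => v s x * Real.exp (-ζ s * Real.cosh x)) s₀ * r x) ∧
    HasDerivAt (fun s => wint (ζ s) (fun x => v s x * r x))
      (∫ x, deriv (fun s => v s x * Real.exp (-ζ s * Real.cosh x)) s₀ * r x) s₀ := by
  -- Integrability, hence additivity of `wint`, is available only where ζ s > 0; for a derivative at
  -- s₀ a neighbourhood is enough.
  have hev : ∀ᶠ s in nhds s₀, 0 < ζ s := hd.continuousAt.eventually (lt_mem_nhds hζ)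
  induction hv with
  | smul a ha K f hf =>
    have hfr := laurent_mul hf hr
    have hcfr := laurent_mul cosh_mem_laurent hfr
    have hderiv : (fun x => deriv (fun s => a s * f x * Real.exp (-ζ s * Real.cosh x)) s₀ * r x) =
        fun x => deriv a s₀ * (f x * r x * Real.exp (-ζ s₀ * Real.cosh x)) +
          -(a s₀ * deriv ζ s₀) *
            (Real.cosh x * (f x * r x) * Real.exp (-ζ s₀ * Real.cosh x)) := by
      ext x
      have h1 : HasDerivAt (fun s => Real.exp (-ζ s * Real.cosh x))
          (Real.exp (-ζ s₀ * Real.cosh x) * (-deriv ζ s₀ * Real.cosh x)) s₀ :=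
        (hd.hasDerivAt.neg.mul_const _).exp
      rw [((ha.hasDerivAt.mul_const (f x)).fun_mul h1).deriv]
      ring
    rw [hderiv]
    have i1 := (laurent_integrable hfr hζ).const_mul (deriv a s₀)
    have i2 := (laurent_integrable hcfr hζ).const_mul (-(a s₀ * deriv ζ s₀))
    refine ⟨i1.add i2, ?_⟩
    rw [integral_add i1 i2, integral_const_mul, integral_const_mul]
    have h2 := ha.hasDerivAt.fun_mul
      ((wint_hasDerivAt hfr hζ).comp s₀ hd.hasDerivAt)
    simp only [mul_assoc, wint_const_mul]
    refine h2.congr_deriv ?_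
    simp only [wint, Function.comp_apply, mul_assoc]
    ring
  | add v w hv hw ihv ihw =>
    obtain ⟨iv, dv⟩ := ihv
    obtain ⟨iw, dw⟩ := ihw
    have hderiv : (fun x => deriv (fun s => (v s x + w s x) * Real.exp (-ζ s * Real.cosh x)) s₀ *
        r x) = fun x => deriv (fun s => v s x * Real.exp (-ζ s * Real.cosh x)) s₀ * r x +
          deriv (fun s => w s x * Real.exp (-ζ s * Real.cosh x)) s₀ * r x := by
      ext x
      simp only [add_mul]
      rw [deriv_fun_add (hv.differentiableAt_mul_exp hd x) (hw.differentiableAt_mul_exp hd x),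
        add_mul]
    rw [hderiv]
    refine ⟨iv.add iw, ?_⟩
    rw [integral_add iv iw]
    refine (dv.fun_add dw).congr_of_eventuallyEq ?_
    obtain ⟨K, hK⟩ := hv.mem_laurent
    obtain ⟨K', hK'⟩ := hw.mem_laurent
    filter_upwards [hev] with s hs
    simp only [add_mul]
    exact wint_add (laurent_mul (hK s) hr) (laurent_mul (hK' s) hr) hs

theorem differentiableAt_wint (hv : DiffFamily s₀ v) {ζ : ℝ → ℝ} (hd : DifferentiableAt ℝ ζ s₀)
    (hζ : 0 < ζ s₀) : DifferentiableAt ℝ (fun s => wint (ζ s) (v s)) s₀ := by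
  have := (hv.hasDerivAt_wint hd hζ (const_mem_laurent 1)).2.differentiableAt
  simpa only [mul_one] using this

theorem eval_cosh {P : ℝ → ℝ[X]} {n : ℕ} (hn : ∀ s, (P s).natDegree ≤ n)
    (hP : ∀ k, DifferentiableAt ℝ (fun s => (P s).coeff k) s₀) :
    DiffFamily s₀ fun s x => (P s).eval (Real.cosh x) := by
  have : (fun s x => (P s).eval (Real.cosh x)) =
      fun s x => ∑ i ∈ Finset.range (n + 1), (P s).coeff i * Real.cosh x ^ i := by
    ext s x
    rw [Polynomial.eval_eq_sum_range' (Nat.lt_succ_of_le (hn s))]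
  rw [this]
  exact DiffFamily.sum _ fun i => DiffFamily.smul _ (hP i) i _ (cosh_pow_mem_laurent i)

end DiffFamily

/-! ### Differentiable dependence of the orthonormal polynomials on ζ. -/

section Smooth

variable {s₀ : ℝ} {ζ : ℝ → ℝ}

theorem differentiableAt_wint_cosh (hd : DifferentiableAt ℝ ζ s₀) (hζ : 0 < ζ s₀) :
    DifferentiableAt ℝ (fun s => wint (ζ s) Real.cosh) s₀ :=
  (DiffFamily.const cosh_mem_laurent).differentiableAt_wint hd hζ

theorem differentiableAt_polyInner (l : ℕ) (hd : DifferentiableAt ℝ ζ s₀) (hζ : 0 < ζ s₀)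
    {P Q : ℝ → ℝ[X]} {m n : ℕ} (hm : ∀ s, (P s).natDegree ≤ m)
    (hP : ∀ k, DifferentiableAt ℝ (fun s => (P s).coeff k) s₀) (hn : ∀ s, (Q s).natDegree ≤ n)
    (hQ : ∀ k, DifferentiableAt ℝ (fun s => (Q s).coeff k) s₀) :
    DifferentiableAt ℝ (fun s => polyInner l (ζ s) (P s) (Q s)) s₀ := by
  simp only [polyInner_eq]
  obtain ⟨N, hN⟩ := eval_mul_mem_laurent l 1 1
  simp only [eval_one, one_mul] at hN
  exact ((((DiffFamily.eval_cosh hm hP).mul (DiffFamily.eval_cosh hn hQ)).mul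
    (DiffFamily.const hN)).differentiableAt_wint hd hζ).fun_div
    (differentiableAt_wint_cosh hd hζ) (wint_cosh_pos hζ).ne'

/-- Induction along Gram–Schmidt: each step uses inner products of earlier polynomials, and the
normalizing square root is differentiable because its radicand is positive. -/
theorem differentiableAt_orthoPoly_coeff (l : ℕ) (hd : DifferentiableAt ℝ ζ s₀) (hζ : 0 < ζ s₀)
    (n k : ℕ) : DifferentiableAt ℝ (fun s => (orthoPoly l (ζ s) n).coeff k) s₀ := by
  induction n using Nat.strong_induction_on generalizing k with
  | _ n ih =>
    have hpre : ∀ k, DifferentiableAt ℝ (fun s => (preOrthoPoly l (ζ s) n).coeff k) s₀ := by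
      intro k
      simp only [preOrthoPoly, coeff_sub, finsetSum_coeff, coeff_C_mul]
      refine DifferentiableAt.fun_sub (by fun_prop) (DifferentiableAt.fun_sum fun i _ => ?_)
      refine DifferentiableAt.fun_mul ?_ (ih i i.2 k)
      exact differentiableAt_polyInner l hd hζ (P := fun _ => X ^ n) (fun _ => natDegree_X_pow_le n)
        (by fun_prop) (fun s => orthoPoly_natDegree_le l (ζ s) i) (ih i i.2)
    have hdeg : ∀ s, (preOrthoPoly l (ζ s) n).natDegree ≤ n := by
      intro s
      refine (natDegree_sub_le_of_le (natDegree_X_pow_le n) (natDegree_sum_le_of_forall_le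
        (n := n) _ _ ?_)).trans (max_self n).le
      intro k _
      exact (natDegree_C_mul_le _ _).trans ((orthoPoly_natDegree_le l _ k).trans k.2.le)
    have hpos := polyInner_self_pos l hζ (preOrthoPoly_ne_zero l (ζ s₀) n)
    simp only [orthoPoly_eq l _ n, coeff_C_mul]
    refine DifferentiableAt.fun_mul (DifferentiableAt.fun_inv ?_ (Real.sqrt_pos.2 hpos).ne') (hpre k)
    exact (differentiableAt_polyInner l hd hζ hdeg hpre hdeg hpre).sqrt hpos.ne'

theorem differentiableAt_orthoPoly_eval_zero (l : ℕ) (hd : DifferentiableAt ℝ ζ s₀)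
    (hζ : 0 < ζ s₀) (n : ℕ) :
    DifferentiableAt ℝ (fun s => (orthoPoly l (ζ s) n).eval 0) s₀ := by
  simp only [← coeff_zero_eq_eval_zero]
  exact differentiableAt_orthoPoly_coeff l hd hζ n 0

theorem DiffFamily.mode (hd : DifferentiableAt ℝ ζ s₀) (hζ : 0 < ζ s₀) (i : ℕ) :
    DiffFamily s₀ fun s x => mode (ζ s) i x := by
  by_cases h : i = 0 ∨ i % 2 = 1
  · simp only [RelMoment.mode, if_pos h]
    exact DiffFamily.eval_cosh (fun s => orthoPoly_natDegree_le 0 (ζ s) _)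
      (differentiableAt_orthoPoly_coeff 0 hd hζ _)
  · simp only [RelMoment.mode, if_neg h, ← mul_neg]
    exact (DiffFamily.eval_cosh (fun s => orthoPoly_natDegree_le 1 (ζ s) _)
      (differentiableAt_orthoPoly_coeff 1 hd hζ _)).mul
      (DiffFamily.const (Submodule.neg_mem _ sinh_mem_laurent))

end Smooth

/-! ### Moments of the partial derivatives of the distribution function. -/

section Profile

variable {M : ℕ}

theorem comp_update (W : Fin (2 * M + 1) → ℝ) (j : Fin (2 * M + 1)) (s : ℝ) (k : ℕ) :
    comp (Function.update W j s) k = if k = j.1 then s else comp W k := by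
  by_cases hk : k < 2 * M + 1
  · simp only [comp, dif_pos hk, Function.update_apply, Fin.ext_iff]
  · have : k ≠ j.1 := fun h => hk (h ▸ j.2)
    simp only [comp, dif_neg hk, if_neg this]

theorem comp_val (W : Fin (2 * M + 1) → ℝ) (j : Fin (2 * M + 1)) : comp W j.1 = W j := by
  rw [comp, dif_pos j.2]

theorem differentiableAt_comp_update (W : Fin (2 * M + 1) → ℝ) (j : Fin (2 * M + 1)) (k : ℕ) :
    DifferentiableAt ℝ (fun s => comp (Function.update W j s) k) (W j) := by
  simp only [comp_update]
  split_ifs <;> fun_prop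

theorem orthoPoly_zero_leadingCoeff (l : ℕ) (ζ : ℝ) :
    (orthoPoly l ζ 0).leadingCoeff = (orthoPoly l ζ 0).coeff 0 := by
  rw [leadingCoeff, Nat.le_zero.1 (orthoPoly_natDegree_le l ζ 0)]

theorem differentiableAt_momentCoeff {W : Fin (2 * M + 1) → ℝ} (hθ : 0 < temperature W)
    (j : Fin (2 * M + 1)) (i : ℕ) :
    DifferentiableAt ℝ (fun s => momentCoeff (Function.update W j s) i) (W j) := by
  have hT : 0 < temperature (Function.update W j (W j)) := by rwa [Function.update_eq_self]
  have hd : DifferentiableAt ℝ (fun s => (temperature (Function.update W j s))⁻¹) (W j) :=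
    (differentiableAt_comp_update W j 2).fun_inv hT.ne'
  have hζ : 0 < (temperature (Function.update W j (W j)))⁻¹ := inv_pos.2 hT
  have hP := fun l n => differentiableAt_orthoPoly_eval_zero l hd hζ n
  have hc := differentiableAt_comp_update W j
  match i with
  | 0 =>
    simp only [momentCoeff, orthoPoly_zero_leadingCoeff]
    exact ((hc 0).fun_div (differentiableAt_orthoPoly_coeff 0 hd hζ 0 0)
      (orthoPoly_coeff_pos 0 hζ 0).ne').fun_sub ((hc 3).fun_mul (hP 0 0))
  | 1 => exact (hc 3).fun_neg.fun_mul (hP 0 1)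
  | 2 => exact (hc 4).fun_neg.fun_mul (hP 1 0)
  | 3 => exact (hc 3).fun_neg.fun_mul (hP 0 2)
  | 4 => exact (hc 4).fun_neg.fun_mul (hP 1 1)
  | i + 5 => exact hc (i + 5)

/-- The distribution function divided by the equilibrium weight, as a function of the rapidity
relative to the mean velocity. -/
def profile (W : Fin (2 * M + 1) → ℝ) (x : ℝ) : ℝ :=
  ∑ i : Fin (2 * M + 1), momentCoeff W i * mode (temperature W)⁻¹ i x

theorem profile_mem_laurent (W : Fin (2 * M + 1) → ℝ) : profile W ∈ laurent M :=
  modeSum_mem_laurent (temperature W)⁻¹ fun i => momentCoeff W i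

/-- The moment of the distribution function with respect to `r`. -/
def moment (W : Fin (2 * M + 1) → ℝ) (r : ℝ → ℝ) : ℝ :=
  wint (temperature W)⁻¹ (fun x => profile W x * r x) / wint (temperature W)⁻¹ Real.cosh

theorem distribution_sinh {W : Fin (2 * M + 1) → ℝ} (hu : |velocity W| < 1) (y : ℝ) :
    distribution M W (Real.sinh y) = (wint (temperature W)⁻¹ Real.cosh)⁻¹ *
      (profile W (y - Real.artanh (velocity W)) *
        Real.exp (-(temperature W)⁻¹ * Real.cosh (y - Real.artanh (velocity W)))) := by
  simp only [distribution, basisFn_sinh hu, g0_sinh hu, profile, Finset.sum_mul, Finset.mul_sum]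
  exact Finset.sum_congr rfl fun i _ => by ring

/-- The moment with respect to `r` of the `j`-th partial derivative of the distribution
function. -/
def derivMoment (W : Fin (2 * M + 1) → ℝ) (j : Fin (2 * M + 1)) (r : ℝ → ℝ) : ℝ :=
  ∫ x, distributionDeriv M W j (Real.sinh (x + Real.artanh (velocity W))) * r x

/-- When the velocity is kept fixed, so is the origin of the relative rapidity, and the derivative
passes through the integral with the same test function. -/
theorem derivMoment_of_ne {W : Fin (2 * M + 1) → ℝ} (hu : |velocity W| < 1)
    (hθ : 0 < temperature W) {j : Fin (2 * M + 1)} (hj : j.1 ≠ 1) {N : ℕ} {r : ℝ → ℝ}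
    (hr : r ∈ laurent N) :
    Integrable (fun x =>
      distributionDeriv M W j (Real.sinh (x + Real.artanh (velocity W))) * r x) ∧
    HasDerivAt (fun s => moment (Function.update W j s) r) (derivMoment W j r) (W j) := by
  have hT : 0 < temperature (Function.update W j (W j)) := by rwa [Function.update_eq_self]
  have hd : DifferentiableAt ℝ (fun s => (temperature (Function.update W j s))⁻¹) (W j) :=
    (differentiableAt_comp_update W j 2).fun_inv hT.ne'
  have hζ : 0 < (temperature (Function.update W j (W j)))⁻¹ := inv_pos.2 hT
  have hvel : ∀ s, velocity (Function.update W j s) = velocity W := fun s => by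
    simp only [velocity, comp_update, if_neg (Ne.symm hj)]
  have hfam : DiffFamily (W j) fun s x => profile (Function.update W j s) x :=
    DiffFamily.sum _ fun i =>
      (DiffFamily.mode hd hζ i).const_mul (differentiableAt_momentCoeff hθ j i)
  have hfam' := hfam.const_mul
    ((differentiableAt_wint_cosh hd hζ).fun_inv (wint_cosh_pos hζ).ne')
  have key := hfam'.hasDerivAt_wint hd hζ hr
  have hdd : ∀ x, distributionDeriv M W j (Real.sinh (x + Real.artanh (velocity W))) =
      deriv (fun s => (wint (temperature (Function.update W j s))⁻¹ Real.cosh)⁻¹ *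
        profile (Function.update W j s) x *
          Real.exp (-(temperature (Function.update W j s))⁻¹ * Real.cosh x)) (W j) := by
    intro x
    rw [distributionDeriv]
    congr 1
    ext s
    rw [distribution_sinh (by rwa [hvel]), hvel, add_sub_cancel_right, mul_assoc]
  simp only [derivMoment, hdd]
  refine ⟨key.1, ?_⟩
  convert! key.2 using 2 with s
  simp only [moment, mul_assoc, wint_const_mul]
  rw [div_eq_inv_mul]

theorem hasDerivAt_artanh {u : ℝ} (hu : |u| < 1) :
    HasDerivAt Real.artanh (1 / (1 - u ^ 2)) u := by
  obtain ⟨h1, h2⟩ := abs_lt.1 hu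
  have ha : HasDerivAt (fun x : ℝ => 1 / 2 * (Real.log (1 + x) - Real.log (1 - x)))
      (1 / 2 * (1 / (1 + u) - -1 / (1 - u))) u :=
    ((((hasDerivAt_id u).const_add 1).log (by simp only [id]; linarith)).fun_sub
      (((hasDerivAt_id u).const_sub 1).log (by simp only [id]; linarith))).const_mul _
  refine (ha.congr_of_eventuallyEq ?_).congr_deriv ?_
  · filter_upwards [Ioo_mem_nhds h1 h2] with x hx
    rw [Real.artanh_eq_half_log (Set.Ioo_subset_Icc_self hx), Real.log_div (by linarith [hx.1])
      (by linarith [hx.2])]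
  · have e1 : 1 + u ≠ 0 := by linarith
    have e2 : 1 - u ≠ 0 := by linarith
    have e3 : 1 - u ^ 2 ≠ 0 := by
      have : 1 - u ^ 2 = (1 + u) * (1 - u) := by ring
      rw [this]; exact mul_ne_zero e1 e2
    field_simp
    ring

/-- Changing u only translates the profile and its weight in rapidity. Integration by parts moves
the resulting x-derivative to r; the factor is the derivative of artanh. -/
theorem derivMoment_velocity {W : Fin (2 * M + 1) → ℝ} (hu : |velocity W| < 1)
    (hθ : 0 < temperature W) {j : Fin (2 * M + 1)} (hj : j.1 = 1) {N : ℕ} {r r' : ℝ → ℝ}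
    (hr : r ∈ laurent N) (hr' : ∀ x, HasDerivAt r (r' x) x) (hr'm : r' ∈ laurent N) :
    Integrable (fun x =>
      distributionDeriv M W j (Real.sinh (x + Real.artanh (velocity W))) * r x) ∧
    derivMoment W j r = 1 / (1 - velocity W ^ 2) * moment W r' := by
  have hζ := inv_pos.2 hθ
  have hWj : W j = velocity W := by rw [velocity, ← hj, comp_val]
  have hvel : ∀ s, velocity (Function.update W j s) = s := fun s => by
    simp only [velocity, comp_update, if_pos hj.symm]
  have htemp : ∀ s, temperature (Function.update W j s) = temperature W := fun s => by
    simp only [temperature, comp_update, hj, OfNat.ofNat_ne_one, if_false]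
  have hcomp : ∀ s k, k ≠ 1 → comp (Function.update W j s) k = comp W k := fun s k hk => by
    simp only [comp_update, hj, if_neg hk]
  have hcoeff : ∀ s i, momentCoeff (Function.update W j s) i = momentCoeff W i := by
    intro s i
    match i with
    | 0 => simp only [momentCoeff, htemp, density, bulkPressure, hcomp s 0 (by norm_num),
        hcomp s 3 (by norm_num)]
    | 1 => simp only [momentCoeff, htemp, bulkPressure, hcomp s 3 (by norm_num)]
    | 2 => simp only [momentCoeff, htemp, diffusion, hcomp s 4 (by norm_num)]
    | 3 => simp only [momentCoeff, htemp, bulkPressure, hcomp s 3 (by norm_num)]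
    | 4 => simp only [momentCoeff, htemp, diffusion, hcomp s 4 (by norm_num)]
    | i + 5 => simp only [momentCoeff, hcomp s (i + 5) (by omega)]
  have hprof : ∀ s, profile (Function.update W j s) = profile W := fun s => by
    ext x; simp only [profile, hcoeff, htemp]
  obtain ⟨f', hf'm, hf'⟩ := laurent_hasDerivAt (profile_mem_laurent W)
  set ζ := (temperature W)⁻¹ with hζdef
  set η := Real.artanh (velocity W) with hη
  have hdd : ∀ x, distributionDeriv M W j (Real.sinh (x + η)) =
      -(1 / (1 - velocity W ^ 2)) * (wint ζ Real.cosh)⁻¹ *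
        ((f' x - ζ * Real.sinh x * profile W x) * Real.exp (-ζ * Real.cosh x)) := by
    intro x
    have hin : HasDerivAt (fun s => x + η - Real.artanh s) (-(1 / (1 - velocity W ^ 2)))
        (velocity W) := (hasDerivAt_artanh hu).const_sub _
    have hx : x + η - Real.artanh (velocity W) = x := by rw [hη]; ring
    have hout : HasDerivAt (fun z => profile W z * Real.exp (-ζ * Real.cosh z))
        ((f' x - ζ * Real.sinh x * profile W x) * Real.exp (-ζ * Real.cosh x))
        (x + η - Real.artanh (velocity W)) := by
      rw [hx]
      have h1 : HasDerivAt (fun x => Real.exp (-ζ * Real.cosh x))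
          (Real.exp (-ζ * Real.cosh x) * (-ζ * Real.sinh x)) x :=
        ((Real.hasDerivAt_cosh x).const_mul _).exp
      exact ((hf' x).mul h1).congr_deriv (by ring)
    have hd := (hout.comp (velocity W) hin).const_mul (wint ζ Real.cosh)⁻¹
    rw [distributionDeriv, hWj]
    refine HasDerivAt.deriv ((hd.congr_of_eventuallyEq ?_).congr_deriv (by ring))
    filter_upwards [Ioo_mem_nhds (abs_lt.1 hu).1 (abs_lt.1 hu).2] with s hs
    rw [distribution_sinh (by rw [hvel]; exact abs_lt.2 hs), hvel, htemp, hprof]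
    rfl
  have hm : (fun x => f' x - ζ * Real.sinh x * profile W x) ∈ laurent (1 + M) := by
    have h1 := laurent_mono (show M ≤ 1 + M by omega) hf'm
    have h2 := laurent_mul sinh_mem_laurent (profile_mem_laurent W)
    convert! Submodule.sub_mem _ h1 (Submodule.smul_mem _ ζ h2) using 1
    ext x; simp only [Pi.sub_apply, Pi.smul_apply, smul_eq_mul]; ring
  have hparts := integral_deriv_weight_mul (profile_mem_laurent W) hf' hf'm hr hr' hr'm hζ
  simp only [derivMoment, ← hη, hdd, mul_assoc (-(1 / (1 - velocity W ^ 2)) * _)]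
  constructor
  · refine Integrable.const_mul ?_ _
    convert! laurent_integrable (laurent_mul hm hr) hζ using 1
    ext x; ring
  · rw [integral_const_mul, hparts, moment]
    ring

theorem derivMoment_integrable {W : Fin (2 * M + 1) → ℝ} (hu : |velocity W| < 1)
    (hθ : 0 < temperature W) (j : Fin (2 * M + 1)) {N : ℕ} {r : ℝ → ℝ} (hr : r ∈ laurent N) :
    Integrable (fun x =>
      distributionDeriv M W j (Real.sinh (x + Real.artanh (velocity W))) * r x) := by
  by_cases hj : j.1 = 1
  · obtain ⟨r', hr'm, hr'⟩ := laurent_hasDerivAt hr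
    exact (derivMoment_velocity hu hθ hj hr hr' hr'm).1
  · exact (derivMoment_of_ne hu hθ hj hr).1

/-- A relation between the columns of the matrix of partial derivatives holds for the moments with
respect to all Laurent polynomials. -/
theorem sum_derivMoment_eq_zero {W : Fin (2 * M + 1) → ℝ} (hu : |velocity W| < 1)
    (hθ : 0 < temperature W) {c : Fin (2 * M + 1) → ℝ} (hc : (derivMatrix M W).mulVec c = 0)
    {r : ℝ → ℝ} (hr : r ∈ laurent M) : ∑ j, c j * derivMoment W j r = 0 := by
  have hζ := inv_pos.2 hθ
  -- The rows of the matrix are the moments against the modes, and these span all admissible test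
  -- functions.
  obtain ⟨d, hd⟩ := exists_sum_mode hζ hr
  have hL : ∀ j, derivMoment W j r = ∑ k, d k * derivMatrix M W k j := by
    intro j
    simp only [derivMatrix, Matrix.of_apply, inner0_basisFn hu hθ, ← integral_const_mul]
    rw [← integral_finsetSum _ fun k _ =>
      (derivMoment_integrable hu hθ j (mode_mem_laurent _ k.2)).const_mul (d k)]
    rw [derivMoment]
    congr 1
    ext x
    rw [hd, Finset.mul_sum]
    exact Finset.sum_congr rfl fun k _ => by ring
  simp only [hL, Finset.mul_sum]
  rw [Finset.sum_comm]
  refine Finset.sum_eq_zero fun k _ => ?_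
  have hk := congrFun hc k
  simp only [Matrix.mulVec, dotProduct, Pi.zero_apply] at hk
  calc ∑ j, c j * (d k * derivMatrix M W k j) = d k * ∑ j, derivMatrix M W k j * c j := by
        rw [Finset.mul_sum]; exact Finset.sum_congr rfl fun j _ => by ring
    _ = 0 := by rw [hk, mul_zero]

end Profile

/-! ### Expansion of monomials in orthonormal polynomials. -/

theorem neg_cosh_pow_mul_sinh_mem_laurent (n : ℕ) :
    (fun x => -(Real.cosh x ^ n * Real.sinh x)) ∈ laurent (n + 1) :=
  Submodule.neg_mem _ (laurent_mul (cosh_pow_mem_laurent n) sinh_mem_laurent)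

theorem X_pow_eq_sum_orthoPoly (l : ℕ) {ζ : ℝ} (hζ : 0 < ζ) (n : ℕ) :
    ∃ a : Fin (n + 1) → ℝ, (X ^ n : ℝ[X]) = ∑ k, C (a k) * orthoPoly l ζ k := by
  have hpos := Real.sqrt_pos.2 (polyInner_self_pos l hζ (preOrthoPoly_ne_zero l ζ n))
  set q := Real.sqrt (polyInner l ζ (preOrthoPoly l ζ n) (preOrthoPoly l ζ n)) with hq
  have h1 : preOrthoPoly l ζ n = C q * orthoPoly l ζ n := by
    rw [orthoPoly_eq l ζ n, ← mul_assoc, ← C_mul, mul_inv_cancel₀ hpos.ne', C_1, one_mul]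
  -- The Gram–Schmidt relation solved for the monomial: the last coefficient is the norm that was
  -- divided out.
  refine ⟨Fin.snoc (α := fun _ => ℝ) (fun k => polyInner l ζ (X ^ n) (orthoPoly l ζ k.1)) q, ?_⟩
  rw [Fin.sum_univ_castSucc]
  simp only [Fin.snoc_castSucc, Fin.snoc_last, Fin.val_castSucc, Fin.val_last]
  rw [← h1, preOrthoPoly]
  ring

theorem orthoPoly_zero_eq (l : ℕ) (ζ : ℝ) :
    orthoPoly l ζ 0 = C ((orthoPoly l ζ 0).leadingCoeff) * 1 := by
  rw [mul_one, orthoPoly_zero_leadingCoeff]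
  exact eq_C_of_natDegree_le_zero (orthoPoly_natDegree_le l ζ 0)

theorem wint_orthoPoly {ζ : ℝ} (hζ : 0 < ζ) (k : ℕ) :
    wint ζ (fun x => (orthoPoly 0 ζ k).eval (Real.cosh x)) / wint ζ Real.cosh =
      if k = 0 then 1 / (orthoPoly 0 ζ 0).leadingCoeff else 0 := by
  have hpos : 0 < (orthoPoly 0 ζ 0).leadingCoeff := by
    rw [orthoPoly_zero_leadingCoeff]; exact orthoPoly_coeff_pos 0 hζ 0
  have h1 := polyInner_orthoPoly 0 hζ 0 k
  rw [orthoPoly_zero_eq, polyInner_C_mul_left, polyInner_eq] at h1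
  simp only [eval_one, one_mul, mul_zero, pow_zero, mul_one] at h1
  rw [eq_comm] at h1
  simp only [eq_comm (a := (0 : ℕ))] at h1
  split_ifs at h1 ⊢ with h
  · rw [eq_div_iff hpos.ne', h1]; ring
  · exact (mul_eq_zero.1 h1.symm).resolve_left hpos.ne'

/-! ### Explicit moments and invertibility of the derivative matrix. -/

section Moments

variable {M : ℕ} {W : Fin (2 * M + 1) → ℝ}

theorem moment_sum {ι : Type*} (t : Finset ι) (hθ : 0 < temperature W) {N : ℕ} (a : ι → ℝ)
    {r : ι → ℝ → ℝ} (hr : ∀ i, r i ∈ laurent N) :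
    moment W (fun x => ∑ i ∈ t, a i * r i x) = ∑ i ∈ t, a i * moment W (r i) := by
  have h : (fun x => profile W x * ∑ i ∈ t, a i * r i x) =
      fun x => ∑ i ∈ t, a i * (profile W x * r i x) := by
    ext x
    rw [Finset.mul_sum]
    exact Finset.sum_congr rfl fun i _ => by ring
  rw [moment, h, wint_sum_mul t a (f := fun i x => profile W x * r i x)
    (fun i _ => laurent_mul (profile_mem_laurent W) (hr i)) (inv_pos.2 hθ), Finset.sum_div]
  exact Finset.sum_congr rfl fun i _ => by rw [moment]; ring

theorem moment_neg (W : Fin (2 * M + 1) → ℝ) (r : ℝ → ℝ) :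
    moment W (fun x => -r x) = -moment W r := by
  simp only [moment, mul_neg, wint, neg_mul, integral_neg, neg_div]

theorem moment_mode (hθ : 0 < temperature W) {k : ℕ} (hk : k < 2 * M + 1) :
    moment W (mode (temperature W)⁻¹ k) = momentCoeff W k := by
  have hζ := inv_pos.2 hθ
  have h : (fun x => profile W x * mode (temperature W)⁻¹ k x) =
      fun x => ∑ i : Fin (2 * M + 1), momentCoeff W i *
        (mode (temperature W)⁻¹ i x * mode (temperature W)⁻¹ k x) := by
    ext x
    rw [profile, Finset.sum_mul]
    exact Finset.sum_congr rfl fun i _ => by ring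
  rw [moment, h, wint_sum_mul Finset.univ (fun i : Fin (2 * M + 1) => momentCoeff W i)
    (f := fun i x => mode (temperature W)⁻¹ i x * mode (temperature W)⁻¹ k x)
    (fun i _ => laurent_mul (mode_mem_laurent _ i.2) (mode_mem_laurent _ hk)) hζ, Finset.sum_div]
  simp only [mul_div_assoc, wint_mode_mul_mode hζ]
  rw [Finset.sum_eq_single (⟨k, hk⟩ : Fin (2 * M + 1))]
  · simp
  · intro i _ hi
    rw [if_neg (fun he => hi (Fin.ext he)), mul_zero]
  · simp

theorem moment_orthoPoly_even (hθ : 0 < temperature W) {k : ℕ} (hk : k ≤ 2) (hkM : k ≤ M) :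
    moment W (fun x => (orthoPoly 0 (temperature W)⁻¹ k).eval (Real.cosh x)) =
      density W * (wint (temperature W)⁻¹
        (fun x => (orthoPoly 0 (temperature W)⁻¹ k).eval (Real.cosh x)) /
          wint (temperature W)⁻¹ Real.cosh) -
      bulkPressure W * (orthoPoly 0 (temperature W)⁻¹ k).eval 0 := by
  rw [wint_orthoPoly (inv_pos.2 hθ)]
  have h := fun i hi => moment_mode (W := W) hθ (k := i) hi
  interval_cases k
  · rw [if_pos rfl, mul_one_div]
    exact h 0 (by omega)
  · rw [if_neg one_ne_zero, mul_zero, zero_sub, ← neg_mul]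
    exact h 1 (by omega)
  · rw [if_neg two_ne_zero, mul_zero, zero_sub, ← neg_mul]
    exact h 3 (by omega)

theorem moment_orthoPoly_odd (hθ : 0 < temperature W) {k : ℕ} (hk : k ≤ 1) (hkM : k + 1 ≤ M) :
    moment W (fun x => -((orthoPoly 1 (temperature W)⁻¹ k).eval (Real.cosh x) * Real.sinh x)) =
      -diffusion W * (orthoPoly 1 (temperature W)⁻¹ k).eval 0 := by
  have h := fun i hi => moment_mode (W := W) hθ (k := i) hi
  interval_cases k
  · exact h 2 (by omega)
  · exact h 4 (by omega)

/-- The coefficients −Π P_k(0) are the values on P_k of the functional −Π times evaluation at E = 0.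
On Eⁿ this functional gives −Π·0ⁿ, so Π is visible only for n = 0. -/
theorem moment_cosh_pow (hθ : 0 < temperature W) {n : ℕ} (hn : n ≤ 2) (hnM : n ≤ M) :
    moment W (fun x => Real.cosh x ^ n) =
      density W * (wint (temperature W)⁻¹ (fun x => Real.cosh x ^ n) /
        wint (temperature W)⁻¹ Real.cosh) - bulkPressure W * 0 ^ n := by
  have hζ := inv_pos.2 hθ
  obtain ⟨a, ha⟩ := X_pow_eq_sum_orthoPoly 0 hζ n
  have he : ∀ y : ℝ, y ^ n = ∑ k, a k * (orthoPoly 0 (temperature W)⁻¹ k).eval y := by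
    intro y
    have := congrArg (eval y) ha
    simpa [eval_finsetSum] using this
  have hm : ∀ k : Fin (n + 1), (fun x => (orthoPoly 0 (temperature W)⁻¹ k).eval (Real.cosh x)) ∈
      laurent n := fun k =>
    eval_cosh_mem_laurent ((orthoPoly_natDegree_le 0 _ k).trans (Nat.lt_succ_iff.1 k.2))
  simp only [he]
  rw [moment_sum Finset.univ hθ a hm, wint_sum_mul Finset.univ a (fun k _ => hm k) hζ,
    Finset.sum_div, Finset.mul_sum, Finset.mul_sum, ← Finset.sum_sub_distrib]
  refine Finset.sum_congr rfl fun k _ => ?_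
  rw [moment_orthoPoly_even hθ (by omega) (by omega)]
  ring

/-- Again evaluation at E = 0, now with factor −ñ¹; equilibrium contributes nothing to odd moments.
-/
theorem moment_cosh_pow_mul_sinh (hθ : 0 < temperature W) {n : ℕ} (hn : n ≤ 1) (hnM : n + 1 ≤ M) :
    moment W (fun x => -(Real.cosh x ^ n * Real.sinh x)) = -diffusion W * 0 ^ n := by
  have hζ := inv_pos.2 hθ
  obtain ⟨a, ha⟩ := X_pow_eq_sum_orthoPoly 1 hζ n
  have he : ∀ y : ℝ, y ^ n = ∑ k, a k * (orthoPoly 1 (temperature W)⁻¹ k).eval y := by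
    intro y
    have := congrArg (eval y) ha
    simpa [eval_finsetSum] using this
  have hm : ∀ k : Fin (n + 1),
      (fun x => -((orthoPoly 1 (temperature W)⁻¹ k).eval (Real.cosh x) * Real.sinh x)) ∈
      laurent (n + 1) := fun k => Submodule.neg_mem _ (laurent_mul
    (eval_cosh_mem_laurent ((orthoPoly_natDegree_le 1 _ k).trans (Nat.lt_succ_iff.1 k.2)))
      sinh_mem_laurent)
  have hf : (fun x => -(Real.cosh x ^ n * Real.sinh x)) = fun x => ∑ k, a k *
      -((orthoPoly 1 (temperature W)⁻¹ k).eval (Real.cosh x) * Real.sinh x) := by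
    ext x
    rw [he, Finset.sum_mul, ← Finset.sum_neg_distrib]
    exact Finset.sum_congr rfl fun k _ => by ring
  rw [hf, moment_sum Finset.univ hθ a hm, he 0, Finset.mul_sum]
  refine Finset.sum_congr rfl fun k _ => ?_
  rw [moment_orthoPoly_odd hθ (by omega) (by omega)]
  ring

theorem derivMoment_eq (hu : |velocity W| < 1) (hθ : 0 < temperature W) {j : Fin (2 * M + 1)}
    (hj : j.1 ≠ 1) {N : ℕ} {r : ℝ → ℝ} (hr : r ∈ laurent N) {g : ℝ → ℝ} {d : ℝ}
    (hg : HasDerivAt g d (W j)) (he : ∀ s, 0 < temperature (Function.update W j s) →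
      moment (Function.update W j s) r = g s) : derivMoment W j r = d := by
  refine (derivMoment_of_ne hu hθ hj hr).2.unique (hg.congr_of_eventuallyEq ?_)
  -- The closed formula is assumed only for positive temperature, an open condition that holds at s
  -- = W j.
  have hc := (differentiableAt_comp_update W j 2).continuousAt
  have hT : 0 < comp (Function.update W j (W j)) 2 := by rwa [Function.update_eq_self]
  filter_upwards [hc.eventually (lt_mem_nhds hT)] with s hs using he s hs

theorem derivMoment_cosh (hu : |velocity W| < 1) (hθ : 0 < temperature W) (hM : 1 ≤ M)
    {j : Fin (2 * M + 1)} (hj : j.1 ≠ 1) :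
    derivMoment W j (fun x => Real.cosh x ^ 1) = if j.1 = 0 then 1 else 0 := by
  refine derivMoment_eq hu hθ hj (g := fun s => if j.1 = 0 then s else density W)
    (cosh_pow_mem_laurent 1) ?_ fun s hs => ?_
  · split_ifs
    · exact hasDerivAt_id _
    · exact hasDerivAt_const _ _
  · rw [moment_cosh_pow hs (by omega) hM]
    simp only [pow_one, div_self (wint_cosh_pos (inv_pos.2 hs)).ne', mul_one, mul_zero, sub_zero,
      density, comp_update, eq_comm (a := (0 : ℕ))]

theorem derivMoment_cosh_pow (hu : |velocity W| < 1) (hθ : 0 < temperature W) {n : ℕ} (hn : n ≤ 2)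
    (hnM : n ≤ M) {j : Fin (2 * M + 1)} (hj : 3 ≤ j.1) :
    derivMoment W j (fun x => Real.cosh x ^ n) = -if j.1 = 3 then 0 ^ n else 0 := by
  refine derivMoment_eq hu hθ (by omega)
    (g := fun s => density W * (wint (temperature W)⁻¹ (fun x => Real.cosh x ^ n) /
        wint (temperature W)⁻¹ Real.cosh) - (if j.1 = 3 then s else bulkPressure W) * 0 ^ n)
    (cosh_pow_mem_laurent n) ?_ fun s hs => ?_
  · split_ifs
    · simpa using ((hasDerivAt_id (W j)).mul_const ((0 : ℝ) ^ n)).const_sub (density W *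
        (wint (temperature W)⁻¹ (fun x => Real.cosh x ^ n) / wint (temperature W)⁻¹ Real.cosh))
    · rw [neg_zero]
      exact hasDerivAt_const _ _
  · rw [moment_cosh_pow hs hn hnM]
    simp only [density, temperature, bulkPressure, comp_update, if_neg (show ¬(0 = j.1) by omega),
      if_neg (show ¬(2 = j.1) by omega), eq_comm (a := (3 : ℕ))]

theorem derivMoment_cosh_pow_mul_sinh (hu : |velocity W| < 1) (hθ : 0 < temperature W) {n : ℕ}
    (hn : n ≤ 1) (hnM : n + 1 ≤ M) {j : Fin (2 * M + 1)} (hj : j.1 ≠ 1) :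
    derivMoment W j (fun x => -(Real.cosh x ^ n * Real.sinh x)) =
      -if j.1 = 4 then 0 ^ n else 0 := by
  refine derivMoment_eq hu hθ hj
    (g := fun s => -(if j.1 = 4 then s else diffusion W) * 0 ^ n)
    (neg_cosh_pow_mul_sinh_mem_laurent n) ?_ fun s hs => ?_
  · split_ifs
    · simpa using ((hasDerivAt_id (W j)).neg.mul_const ((0 : ℝ) ^ n))
    · rw [neg_zero]
      exact hasDerivAt_const _ _
  · rw [moment_cosh_pow_mul_sinh hs hn hnM]
    simp only [diffusion, comp_update, eq_comm (a := (4 : ℕ))]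

/-- For j ≥ 3 the temperature, and with it the test mode, does not vary; from index 5 on, the
expansion coefficients are the state components themselves. -/
theorem derivMoment_mode (hu : |velocity W| < 1) (hθ : 0 < temperature W)
    {j k : Fin (2 * M + 1)} (hj : 3 ≤ j.1) (hk : 5 ≤ k.1) :
    derivMoment W j (mode (temperature W)⁻¹ k) = if k.1 = j.1 then 1 else 0 := by
  have hT : ∀ s, temperature (Function.update W j s) = temperature W := fun s => by
    simp only [temperature, comp_update, if_neg (show ¬(2 = j.1) by omega)]
  refine derivMoment_eq hu hθ (by omega) (g := fun s => if k.1 = j.1 then s else comp W k)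
    (mode_mem_laurent _ k.2) ?_ fun s hs => ?_
  · split_ifs
    · exact hasDerivAt_id _
    · exact hasDerivAt_const _ _
  · have h := moment_mode hs k.2
    rw [hT] at h
    rw [h]
    obtain ⟨i, hi⟩ : ∃ i, k.1 = i + 5 := ⟨k.1 - 5, by omega⟩
    rw [hi, momentCoeff, comp_update]

/-- Strict Cauchy–Schwarz inequality for the powers of `cosh`. -/
theorem wint_cosh_pow_sq_lt {ζ : ℝ} (hζ : 0 < ζ) (m : ℕ) :
    wint ζ (fun x => Real.cosh x ^ (m + 1)) ^ 2 <
      wint ζ (fun x => Real.cosh x ^ m) * wint ζ (fun x => Real.cosh x ^ (m + 2)) := by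
  have h0 : 0 < wint ζ (fun x => Real.cosh x ^ m) :=
    wint_pos (cosh_pow_mem_laurent m) (fun x => pow_nonneg (Real.cosh_pos x).le _) (x₀ := 0)
      (by simp) hζ
  set a := wint ζ (fun x => Real.cosh x ^ m)
  set b := wint ζ (fun x => Real.cosh x ^ (m + 1))
  -- Strictness comes from cosh not being constant: the square completed at the weighted mean b/a
  -- has positive integral.
  obtain ⟨x₀, hx₀⟩ : ∃ x₀, Real.cosh x₀ - b / a ≠ 0 := by
    by_contra! h
    have h1 := h 0
    have h2 := h 1
    have h3 : 1 < Real.cosh 1 := Real.one_lt_cosh.2 one_ne_zero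
    rw [Real.cosh_zero] at h1
    linarith
  have hm0 := cosh_pow_mem_laurent m
  have hm1 := cosh_pow_mem_laurent (m + 1)
  have hm2 := cosh_pow_mem_laurent (m + 2)
  have hexp : (fun x => Real.cosh x ^ m * (Real.cosh x - b / a) ^ 2) = fun x =>
      Real.cosh x ^ (m + 2) - (2 * (b / a) * Real.cosh x ^ (m + 1) -
        (b / a) ^ 2 * Real.cosh x ^ m) := by
    ext x; ring
  have hs1 : (fun x => 2 * (b / a) * Real.cosh x ^ (m + 1)) ∈ laurent (m + 1) :=
    Submodule.smul_mem _ _ hm1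
  have hs0 : (fun x => (b / a) ^ 2 * Real.cosh x ^ m) ∈ laurent (m + 1) :=
    Submodule.smul_mem _ _ (laurent_mono (Nat.le_succ m) hm0)
  have hs : (fun x => 2 * (b / a) * Real.cosh x ^ (m + 1) - (b / a) ^ 2 * Real.cosh x ^ m) ∈
      laurent (m + 1) := Submodule.sub_mem _ hs1 hs0
  have hpos : 0 < wint ζ (fun x => Real.cosh x ^ m * (Real.cosh x - b / a) ^ 2) := by
    refine wint_pos (N := m + 2) (f := fun x => Real.cosh x ^ m * (Real.cosh x - b / a) ^ 2) ?_
      (fun x => mul_nonneg (pow_nonneg (Real.cosh_pos x).le _) (sq_nonneg _)) (x₀ := x₀)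
      (mul_ne_zero (pow_ne_zero _ (Real.cosh_pos _).ne') (pow_ne_zero _ hx₀)) hζ
    rw [hexp]
    exact Submodule.sub_mem _ hm2 (laurent_mono (Nat.le_succ _) hs)
  rw [hexp, wint_sub hm2 hs hζ, wint_sub hs1 hs0 hζ, wint_const_mul, wint_const_mul] at hpos
  have h1 : 0 < a * (wint ζ (fun x => Real.cosh x ^ (m + 2)) - (2 * (b / a) * b -
      (b / a) ^ 2 * a)) := mul_pos h0 hpos
  have h2 : a * (2 * (b / a) * b - (b / a) ^ 2 * a) = b ^ 2 := by field_simp; ring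
  linarith

/-- Writing ⟨·⟩ for `wint`, the ζ-derivative of ⟨coshⁿ⟩/⟨cosh⟩ has numerator ⟨coshⁿ⟩⟨cosh²⟩ −
⟨coshⁿ⁺¹⟩⟨cosh⟩. By strict Cauchy–Schwarz it is positive for n = 0 and negative for n = 2; for n = 1
it vanishes. -/
theorem derivMoment_temperature_ne_zero (hρ : 0 < density W) (hu : |velocity W| < 1)
    (hθ : 0 < temperature W) {n : ℕ} (hn : n = 0 ∨ n = 2) (hnM : n ≤ M)
    {j : Fin (2 * M + 1)} (hj : j.1 = 2) :
    derivMoment W j (fun x => Real.cosh x ^ n) ≠ 0 := by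
  have hζ := inv_pos.2 hθ
  have hWj : W j = temperature W := by rw [temperature, ← hj, comp_val]
  have hJ := wint_cosh_pos hζ
  have hq := (((wint_hasDerivAt (cosh_pow_mem_laurent n) hζ).fun_div
    (wint_hasDerivAt cosh_mem_laurent hζ) hJ.ne').comp (temperature W)
    (hasDerivAt_inv hθ.ne')).const_mul (density W)
  have hq' := hq.sub_const (bulkPressure W * 0 ^ n)
  rw [← hWj] at hq'
  rw [derivMoment_eq hu hθ (by omega) (cosh_pow_mem_laurent n) hq' fun s hs => ?_]
  · rw [hWj]
    refine mul_ne_zero hρ.ne' (mul_ne_zero (div_ne_zero ?_ (pow_ne_zero _ hJ.ne'))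
      (neg_ne_zero.2 (inv_ne_zero (pow_ne_zero _ hθ.ne'))))
    rcases hn with rfl | rfl
    · have h := wint_cosh_pow_sq_lt hζ 0
      simp only [pow_zero, zero_add, pow_one, mul_one, pow_two (Real.cosh _)] at h ⊢
      intro h'
      linarith
    · have h := wint_cosh_pow_sq_lt hζ 1
      have e1 : (fun x => Real.cosh x * Real.cosh x ^ 2) = fun x => Real.cosh x ^ (1 + 2) := by
        ext x; ring
      have e2 : (fun x => Real.cosh x * Real.cosh x) = fun x => Real.cosh x ^ (1 + 1) := by
        ext x; ring
      simp only [pow_one] at h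
      rw [e1, e2]
      simp only [Nat.reduceAdd] at h ⊢
      intro h'
      linarith
  · have h2 : temperature (Function.update W j s) = s := by
      simp only [temperature, comp_update, if_pos hj.symm]
    rw [moment_cosh_pow hs (by omega) hnM, h2]
    simp only [density, bulkPressure, comp_update, hj, OfNat.zero_ne_ofNat, Nat.reduceEqDiff,
      if_false, Function.comp_apply]

/-- Integrating the derivative of the weight against sinh gives ζ⟨sinh²⟩ = ⟨cosh⟩; then cosh² = 1 +
sinh². -/
theorem wint_cosh_sq {ζ : ℝ} (hζ : 0 < ζ) : wint ζ (fun x => Real.cosh x ^ 2) =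
    wint ζ (fun x => Real.cosh x ^ 0) + ζ⁻¹ * wint ζ Real.cosh := by
  have h := integral_deriv_weight_mul (const_mem_laurent 1) (f' := fun _ => 0)
    (fun x => hasDerivAt_const x 1) (const_mem_laurent 0) sinh_mem_laurent Real.hasDerivAt_sinh
    cosh_mem_laurent hζ
  have h1 : wint ζ (fun x => Real.sinh x * Real.sinh x) = ζ⁻¹ * wint ζ Real.cosh := by
    have e : ∀ x, (0 - ζ * Real.sinh x * 1) * Real.exp (-ζ * Real.cosh x) * Real.sinh x =
        -ζ * (Real.sinh x * Real.sinh x * Real.exp (-ζ * Real.cosh x)) := fun x => by ring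
    simp only [e, integral_const_mul, one_mul] at h
    rw [wint, eq_inv_mul_iff_mul_eq₀ hζ.ne']
    linarith
  rw [← h1, ← wint_add (cosh_pow_mem_laurent 0) (laurent_mul sinh_mem_laurent sinh_mem_laurent) hζ]
  congr 1
  ext x
  rw [Real.cosh_sq]; ring

/-- Up to the factor 1/(1−u²), the value is the moment of the derivative of the test function. For M
= 1 that derivative is −cosh and the moment is −ρ. For M ≥ 2 it is 1 − 2cosh², with moment
−(ρ⟨1⟩/⟨cosh⟩ + 2ρθ + Π), which is negative because Π > −ρθ. -/
theorem derivMoment_velocity_ne_zero (hM : 1 ≤ M) (hW : Admissible W) {j : Fin (2 * M + 1)}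
    (hj : j.1 = 1) : derivMoment W j (fun x => -(Real.cosh x ^ (min M 2 - 1) * Real.sinh x)) ≠
      0 := by
  obtain ⟨hρ, hu, hθ, hP⟩ := hW
  have hζ := inv_pos.2 hθ
  have hJ := wint_cosh_pos hζ
  have hu2 : 1 / (1 - velocity W ^ 2) ≠ 0 := by
    have : velocity W ^ 2 < 1 := by rw [← sq_abs]; nlinarith [abs_nonneg (velocity W)]
    exact one_div_ne_zero (by linarith)
  rcases Nat.eq_or_lt_of_le hM with rfl | hM2
  · have hd : ∀ x, HasDerivAt (fun x => -(Real.cosh x ^ 0 * Real.sinh x)) (-Real.cosh x ^ 1) x := by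
      intro x
      simpa using! (Real.hasDerivAt_sinh x).neg
    rw [show min 1 2 - 1 = 0 from rfl, (derivMoment_velocity hu hθ hj
      (neg_cosh_pow_mul_sinh_mem_laurent 0) hd (Submodule.neg_mem _ (cosh_pow_mem_laurent 1))).2,
      moment_neg, moment_cosh_pow hθ (by omega) le_rfl]
    simp only [pow_one, div_self hJ.ne', mul_one, mul_zero, sub_zero]
    exact mul_ne_zero hu2 (neg_ne_zero.2 hρ.ne')
  · have hM2' : 2 ≤ M := hM2
    rw [show min M 2 - 1 = 1 by omega]
    have hd : ∀ x, HasDerivAt (fun x => -(Real.cosh x ^ 1 * Real.sinh x))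
        (∑ i : Fin 2, ![1, -2] i * Real.cosh x ^ (2 * i.1)) x := by
      intro x
      have h := ((Real.hasDerivAt_cosh x).fun_mul (Real.hasDerivAt_sinh x)).fun_neg
      simp only [pow_one]
      refine h.congr_deriv ?_
      simp only [Fin.sum_univ_two, Matrix.cons_val_zero, Matrix.cons_val_one, Fin.val_zero,
        Fin.val_one, mul_zero, mul_one, pow_zero]
      linear_combination Real.cosh_sq x
    have hpow : ∀ i : Fin 2, (fun x => Real.cosh x ^ (2 * i.1)) ∈ laurent (1 + 1) := fun i =>
      laurent_mono (by omega) (cosh_pow_mem_laurent (2 * i.1))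
    have hmem : (fun x => ∑ i : Fin 2, ![1, -2] i * Real.cosh x ^ (2 * i.1)) ∈
        laurent (1 + 1) := by
      convert! Submodule.sum_mem _ fun (i : Fin 2) (_ : i ∈ Finset.univ) =>
        Submodule.smul_mem _ ((![1, -2] : Fin 2 → ℝ) i) (hpow i) using 1
    rw [(derivMoment_velocity hu hθ hj (neg_cosh_pow_mul_sinh_mem_laurent 1) hd hmem).2,
      moment_sum _ hθ _ hpow, Fin.sum_univ_two]
    refine mul_ne_zero hu2 ?_
    simp only [Matrix.cons_val_zero, Matrix.cons_val_one, Fin.val_zero, Fin.val_one, mul_zero,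
      mul_one]
    rw [moment_cosh_pow hθ (by omega) (by omega), moment_cosh_pow hθ le_rfl hM2',
      wint_cosh_sq hζ, inv_inv, add_div, mul_div_cancel_right₀ _ hJ.ne']
    have h0 : 0 < wint (temperature W)⁻¹ (fun x => Real.cosh x ^ 0) /
        wint (temperature W)⁻¹ Real.cosh := div_pos (wint_pos (cosh_pow_mem_laurent 0)
      (fun x => by simp) (x₀ := 0) (by simp) hζ) hJ
    have h1 := mul_pos hρ h0
    have h2 := mul_pos hρ hθ
    simp only [pow_zero, ne_eq, OfNat.ofNat_ne_zero, not_false_eq_true, zero_pow]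
    simp only [pow_zero] at h1
    intro h
    linarith

/-- A kernel vector is eliminated in the order u, ρ, θ, Π, ñ¹, then the remaining coefficients. Each
test function has a nonzero moment in its own column and zero moments in all columns not yet
eliminated. -/
theorem isUnit_derivMatrix (hM : 1 ≤ M) (hW : Admissible W) : IsUnit (derivMatrix M W) := by
  obtain ⟨hρ, hu, hθ, -⟩ := id hW
  rw [← Matrix.mulVec_injective_iff_isUnit]
  refine (injective_iff_map_eq_zero (derivMatrix M W).mulVecLin).2 fun c hc => ?_
  rw [Matrix.mulVecLin_apply] at hc
  have step : ∀ (j : Fin (2 * M + 1)) (r : ℝ → ℝ), r ∈ laurent M → derivMoment W j r ≠ 0 →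
      (∀ i, i ≠ j → c i = 0 ∨ derivMoment W i r = 0) → c j = 0 := by
    intro j r hr hne h
    have hs := sum_derivMoment_eq_zero hu hθ hc hr
    rw [Finset.sum_eq_single j (fun i _ hi => mul_eq_zero.2 (h i hi)) (by simp)] at hs
    exact (mul_eq_zero.1 hs).resolve_right hne
  have hsinh : ∀ n, n + 1 ≤ M → (fun x => -(Real.cosh x ^ n * Real.sinh x)) ∈ laurent M :=
    fun n hn => laurent_mono hn (neg_cosh_pow_mul_sinh_mem_laurent n)
  have hcosh : ∀ n, n ≤ M → (fun x => Real.cosh x ^ n) ∈ laurent M :=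
    fun n hn => laurent_mono hn (cosh_pow_mem_laurent n)
  -- The exponent is 1 for M ≥ 2, where 0¹ = 0 hides the column of ñ¹, and 0 for M = 1, where that
  -- column does not exist.
  have c1 : ∀ j : Fin (2 * M + 1), j.1 = 1 → c j = 0 := fun j hj => by
    refine step j _ (hsinh (min M 2 - 1) (by omega)) (derivMoment_velocity_ne_zero hM hW hj)
      fun i hi => Or.inr ?_
    have hi1 : i.1 ≠ 1 := fun h => hi (Fin.ext (h.trans hj.symm))
    rw [derivMoment_cosh_pow_mul_sinh hu hθ (by omega) (by omega) hi1]
    split_ifs with h4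
    · rw [show min M 2 - 1 = 1 by omega]; simp
    · simp
  have c0 : ∀ j : Fin (2 * M + 1), j.1 = 0 → c j = 0 := fun j hj => by
    refine step j _ (hcosh 1 hM) ?_ fun i hi => ?_
    · rw [derivMoment_cosh hu hθ hM (by omega), if_pos hj]; exact one_ne_zero
    · by_cases hi1 : i.1 = 1
      · exact Or.inl (c1 i hi1)
      · right
        rw [derivMoment_cosh hu hθ hM hi1, if_neg fun h => hi (Fin.ext (h.trans hj.symm))]
  have c2 : ∀ j : Fin (2 * M + 1), j.1 = 2 → c j = 0 := fun j hj => by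
    -- For M ≥ 2 the test function cosh² does not see Π. For M = 1 it is outside the space, but
    -- there is no Π column and the constant 1 serves.
    obtain ⟨n, hn, hnM, hn3⟩ : ∃ n, (n = 0 ∨ n = 2) ∧ n ≤ M ∧ (1 < M → n = 2) := by
      rcases Nat.eq_or_lt_of_le hM with h | h
      · exact ⟨0, Or.inl rfl, by omega, by omega⟩
      · exact ⟨2, Or.inr rfl, h, fun _ => rfl⟩
    refine step j _ (hcosh n hnM) (derivMoment_temperature_ne_zero hρ hu hθ hn hnM hj)
      fun i hi => ?_
    have hi2 : i.1 ≠ 2 := fun h => hi (Fin.ext (h.trans hj.symm))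
    rcases (by omega : i.1 = 0 ∨ i.1 = 1 ∨ 3 ≤ i.1) with h | h | h
    · exact Or.inl (c0 i h)
    · exact Or.inl (c1 i h)
    · right
      rw [derivMoment_cosh_pow hu hθ (by omega) hnM h, hn3 (by omega)]
      simp
  have c3 : ∀ j : Fin (2 * M + 1), j.1 = 3 → c j = 0 := fun j hj => by
    refine step j _ (hcosh 0 (by omega)) ?_ fun i hi => ?_
    · rw [derivMoment_cosh_pow hu hθ (by omega) (by omega) (by omega), if_pos hj]; simp
    · have hi3 : i.1 ≠ 3 := fun h => hi (Fin.ext (h.trans hj.symm))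
      rcases (by omega : i.1 = 0 ∨ i.1 = 1 ∨ i.1 = 2 ∨ 3 ≤ i.1) with h | h | h | h
      · exact Or.inl (c0 i h)
      · exact Or.inl (c1 i h)
      · exact Or.inl (c2 i h)
      · right
        rw [derivMoment_cosh_pow hu hθ (by omega) (by omega) h, if_neg hi3, neg_zero]
  have c4 : ∀ j : Fin (2 * M + 1), j.1 = 4 → c j = 0 := fun j hj => by
    refine step j _ (hsinh 0 (by omega)) ?_ fun i hi => ?_
    · rw [derivMoment_cosh_pow_mul_sinh hu hθ (by omega) (by omega) (by omega), if_pos hj]; simp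
    · have hi4 : i.1 ≠ 4 := fun h => hi (Fin.ext (h.trans hj.symm))
      by_cases hi1 : i.1 = 1
      · exact Or.inl (c1 i hi1)
      · right
        rw [derivMoment_cosh_pow_mul_sinh hu hθ (by omega) (by omega) hi1, if_neg hi4, neg_zero]
  ext k
  rcases (by omega : k.1 = 0 ∨ k.1 = 1 ∨ k.1 = 2 ∨ k.1 = 3 ∨ k.1 = 4 ∨ 5 ≤ k.1) with
    h | h | h | h | h | h
  · exact c0 k h
  · exact c1 k h
  · exact c2 k h
  · exact c3 k h
  · exact c4 k h
  · refine step k _ (mode_mem_laurent (temperature W)⁻¹ k.2) ?_ fun i hi => ?_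
    · rw [derivMoment_mode hu hθ (by omega) h, if_pos rfl]; exact one_ne_zero
    · rcases (by omega : i.1 = 0 ∨ i.1 = 1 ∨ i.1 = 2 ∨ 3 ≤ i.1) with h' | h' | h' | h'
      · exact Or.inl (c0 i h')
      · exact Or.inl (c1 i h')
      · exact Or.inl (c2 i h')
      · right
        rw [derivMoment_mode hu hθ h' h, if_neg fun he => hi (Fin.ext he.symm)]

end Moments

end

end RelMoment

theorem mainTheorem1 (M : ℕ) (hM : 1 ≤ M) :
    RelMoment.IsStrictlyHyperbolicOn (RelMoment.B0 M) (RelMoment.B1 M)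
      {W | RelMoment.Admissible W} ∧
    ∀ W : Fin (2 * M + 1) → ℝ, RelMoment.Admissible W →
      spectralRadius ℂ
        (((RelMoment.B0 M W)⁻¹ * RelMoment.B1 M W).map (algebraMap ℝ ℂ)) < 1 := by
  have key := fun (W : Fin (2 * M + 1) → ℝ) (hW : RelMoment.Admissible W) =>
    RelMoment.hyperbolic_of_isUnit_derivMatrix hW.2.1 hW.2.2.1 (RelMoment.isUnit_derivMatrix hM hW)
  exact ⟨fun W hW => (key W hW).1, fun W hW => (key W hW).2⟩
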